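/- Let $n\ge 2$, let $\Lambda=\mathbf Z[t^{\pm1},q^{\pm1}]$, and let $B_n$ be the braid group with Artin generators $\sigma_1,\dots,\sigma_{n-1}$; in a product $\beta\gamma$ the braid $\beta$ is placed above $\gamma$. "Algebra" means associative, not necessarily unital, $\Lambda$-algebra. **The matrix algebra $\mathcal M_n$.** Let $V_n$ be the free $\Lambda$-module on $\{X_{i,j}: 1\le i<j\le n\}$, regarded as row vectors, with the right Lawrence–Krammer action of $B_n$ $$X_{i,j}\sigma_m=\begin{cases}X_{i-1,j}& m=i-1\\ X_{i,j-1}& i<m=j-1\\ -tq^2X_{i,j}& m=i=j-1\\ qX_{i+1,j}+(1-q)X_{i,j}+tq(1-q)X_{i,i+1}& m=i<j-1\\ qX_{i,j+1}+(1-q)X_{i,j}-q(1-q)X_{j,j+1}& m=j\\ X_{i,j}&\text{otherwise,}\end{cases}$$ and let $\mathcal K(\beta)$ be the matrix of $\beta$, so $\mathcal K\colon B_n\to GL(n(n-1)/2,\Lambda)$ is a homomorphism. Put $X_{1,2}^*X_{1,2}=-\mathcal K(\sigma_1)+q\,\mathcal K(\sigma_1^{-1})+(1-q)I$. Then $\mathcal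 M_n$ is the $\Lambda$-span of the biforks $\mathcal K(\beta)X_{1,2}^*X_{1,2}\mathcal K(\gamma)$, $\beta,\gamma\in B_n$; it is closed under matrix multiplication. With $A_{i,j}=(\sigma_{i-1}\cdots\sigma_1)(\sigma_{j-1}\cdots\sigma_2)$, the standard biforks are $X_{i,j}^*X_{k,l}=\mathcal K(A_{i,j})X_{1,2}^*X_{1,2}\mathcal K(A_{k,l}^{-1})$ for $i<j$, $k<l$. **Geometric biforks.** A geometric bifork consists of $n$ strings in a cylinder with exactly one local minimum (joining two strings that come from the top) and one local maximum (joining two strings that come from the bottom), together with a descending handle from the minimum to the maximum that is disjoint from the other $n-2$ strings, which are monotone. The two strings carrying the handle are its tines. Cutting at the two vertices, it is given by a quadruple $(u,h,m,l)$: a braid $u\in B_n$ above the minimum; the position $h\in\{1,\dots,n-1\}$ such that the upper tines reach the minimum in positions $h,h+1$; a braid $m\in B_{n-1}$ between the vertices whose strand starting in position $h$ is the handle; and a braid $l\in B_n$ below the maximum, the lower tines leaving the maximum in positions $h',h'+1$, where $h'=m(h)$ is the bottom position of the strand of $m$ starting in position $h$. For a generator $\tau_i$ of $B_{n-1}$ let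 $D_h(\tau_i)\in B_n$ be obtained by doubling the strand starting in position $h$: it is $\sigma_i$ if $i+1<h$, $\sigma_i\sigma_{i+1}$ if $i+1=h$, $\sigma_{i+1}\sigma_i$ if $i=h$, and $\sigma_{i+1}$ if $i>h$. Geometric biforks are considered up to the isotopies generated by $$(u,h,\tau_i m,l)\sim(u\,D_h(\tau_i),\tau_i(h),m,l),\quad (u,h,m\tau_i,l)\sim(u,h,m,D_{m(h)}(\tau_i)\,l),\quad (u\sigma_h,h,m,l)\sim(u,h,m,\sigma_{m(h)}l)$$ (crossings slide across the vertices; a half twist of the tines is transported along the handle, but cannot simply be removed: vertices and handle are flat bands). Write $[u,h,m,l]$ for the isotopy class. **The skein algebra $\mathcal T_n$** is the algebra generated by the geometric biforks, multiplied by concatenation, that is $[u,h,m,lb]\,[u',h',m',l']=[u,h,m,l]\,[bu',h',m',l']$ for $b\in B_n$, with the following skein relations, for all braids $u,m,l,b,c$ and all admissible $h,h',i$: * (f1) $[b\sigma_iu,h,m,l]-q[b\sigma_i^{-1}u,h,m,l]=(1-q)[bu,h,m,l]-[b,i,1,1]\,[u,h,m,l]$ and $[u,h,m,l\sigma_ic]-q[u,h,m,l\sigma_i^{-1}c]=(1-q)[u,h,m,lc]-[u,h,m,l]\,[1,i,1,c]$;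 * (f2) $[b,h,1,\sigma_hc]=-tq^2[b,h,1,c]$; * (f3) $[b,h,\tau_i,c]=[b,h,1,c]$ if $h\notin\{i,i+1\}$, and $[b,h,1,1]\,[1,h',1,c]=0$ if $|h-h'|\ge2$; * (f4) $[b,h,\tau_i^2,c]=q^2[b,h,1,c]$ if $h\in\{i,i+1\}$; $[b,i,1,1]\,[1,i+1,1,c]=q(1-q)[b,i,\tau_i^{-1},c]$; $[b,i+1,1,1]\,[1,i,1,c]=q(1-q)[b,i+1,\tau_i^{-1},c]$. The standard geometric biforks are $\mathbf x_{i,j}^*\mathbf x_{k,l}=[A_{i,j},1,1,A_{k,l}^{-1}]$ for $i<j$, $k<l$. **Theorem.** There is an isomorphism of $\Lambda$-algebras $\rho\colon\mathcal T_n\to\mathcal M_n$ with $\rho(\mathbf x_{i,j}^*\mathbf x_{k,l})=X_{i,j}^*X_{k,l}$ for all $1\le i<j\le n$ and $1\le k<l\le n$. -/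

import Mathlib

open Matrix

namespace LKBifork

noncomputable section

/-! ### The braid groups -/

/-- Artin's relations for the generators `σ 0, …, σ (s-1)` of the braid group on `s + 1` strands. -/
inductive ArtinRel (s : ℕ) : FreeGroup (Fin s) → Prop
  | far (i j : Fin s) (h : i.val + 1 < j.val) :
      ArtinRel s (FreeGroup.of i * FreeGroup.of j *
        (FreeGroup.of j * FreeGroup.of i)⁻¹)
  | braid (i j : Fin s) (h : i.val + 1 = j.val) :
      ArtinRel s (FreeGroup.of i * FreeGroup.of j * FreeGroup.of i *
        (FreeGroup.of j * FreeGroup.of i * FreeGroup.of j)⁻¹)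

/-- The braid group on `s + 1` strands.  Products are read from top to bottom: in `β * γ` the
braid `β` is stacked above `γ`. -/
abbrev Braid (s : ℕ) : Type := PresentedGroup {r | ArtinRel s r}

/-- The Artin generator `σ i`, crossing the strands in positions `i` and `i + 1`
(positions are numbered from `0`). -/
def σ {s : ℕ} (i : Fin s) : Braid s := PresentedGroup.of i

/-- Build a homomorphism out of the braid group from its values on the Artin generators. -/
def braidLift {s : ℕ} {G : Type*} [Group G] (f : Fin s → G)
    (hfar : ∀ i j : Fin s, i.val + 1 < j.val → f i * f j = f j * f i)
    (hbraid : ∀ i j : Fin s, i.val + 1 = j.val → f i * f j * f i = f j * f i * f j) :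
    Braid s →* G :=
  PresentedGroup.toGroup (f := f) (by
    rintro r (⟨i, j, h⟩ | ⟨i, j, h⟩)
    · simp only [map_mul, map_inv, FreeGroup.lift_apply_of]
      exact mul_inv_eq_one.2 (hfar i j h)
    · simp only [map_mul, map_inv, FreeGroup.lift_apply_of]
      exact mul_inv_eq_one.2 (hbraid i j h))

theorem braidLift_σ {s : ℕ} {G : Type*} [Group G] (f : Fin s → G) (hfar hbraid) (i : Fin s) :
    braidLift f hfar hbraid (σ i) = f i :=
  PresentedGroup.toGroup.of _

/-- The transposition of the positions `i` and `i + 1` among `s + 1` positions. -/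
def adjSwap {s : ℕ} (i : Fin s) : Equiv.Perm (Fin (s + 1)) := Equiv.swap i.castSucc i.succ

/-- The underlying permutation of a braid, with `σ i ↦ adjSwap i`. -/
def braidPerm (s : ℕ) : Braid s →* Equiv.Perm (Fin (s + 1)) :=
  braidLift adjSwap
    (by
      intro i j h
      refine (Equiv.Perm.disjoint_swap_swap ?_).commute
      simp [Fin.ext_iff]
      omega)
    (by
      intro i j h
      have hj : j.castSucc = i.succ := Fin.ext (by simp [h])
      have h1 : i.castSucc ≠ i.succ := by simp [Fin.ext_iff]
      have h2 : i.castSucc ≠ j.succ := by simp [Fin.ext_iff]; omega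
      have h3 : i.succ ≠ j.succ := by simp [Fin.ext_iff]; omega
      simp only [adjSwap, hj]
      rw [Equiv.swap_mul_swap_mul_swap h1 h2, Equiv.swap_comm i.castSucc i.succ,
        Equiv.swap_comm i.succ j.succ, Equiv.swap_mul_swap_mul_swap h3.symm h2.symm,
        Equiv.swap_comm])

/-- The bottom position of the strand of the braid `m` that starts in position `h` at the top. -/
def trace {s : ℕ} (h : Fin (s + 1)) (m : Braid s) : Fin (s + 1) := (braidPerm s m)⁻¹ h

/-- `A_{π(i,j)} = (σ_{i-1} ⋯ σ_1)(σ_{j-1} ⋯ σ_2)` for strands numbered from `1`; with the strands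
numbered from `0` this is `(σ (i-1) ⋯ σ 0) * (σ (j-1) ⋯ σ 1)`. -/
def permBraid {k : ℕ} (i j : Fin (k + 2)) : Braid (k + 1) :=
  ((List.finRange i.val).reverse.map fun a => σ ⟨a.val, by omega⟩).prod *
    ((List.finRange (j.val - 1)).reverse.map fun a => σ ⟨a.val + 1, by omega⟩).prod

/-! ### The ring of coefficients and the Lawrence–Krammer representation -/

/-- `Λ = ℤ[t^{±1}, q^{±1}]`. -/
abbrev Λ : Type := LaurentPolynomial (LaurentPolynomial ℤ)

def t : Λ := LaurentPolynomial.C (LaurentPolynomial.T 1)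
def tinv : Λ := LaurentPolynomial.C (LaurentPolynomial.T (-1))
def q : Λ := LaurentPolynomial.T 1
def qinv : Λ := LaurentPolynomial.T (-1)

theorem t_mul_tinv : t * tinv = 1 := by
  rw [t, tinv, ← map_mul, ← LaurentPolynomial.T_add]; simp

theorem q_mul_qinv : q * qinv = 1 := by
  rw [q, qinv, ← LaurentPolynomial.T_add]; simp

/-- The index set of the standard forks `X_{i,j}`, for `n = k + 2` strands numbered
from `0` to `k + 1`. -/
abbrev Pair (k : ℕ) : Type := {p : Fin (k + 2) × Fin (k + 2) // p.1 < p.2}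

/-- The standard fork `X_{i,j}` as a row vector: its entry at `(i,j)` is `1`, all others are `0`. -/
def X (k i j : ℕ) : Pair k → Λ := fun r => if r.1.1.val = i ∧ r.1.2.val = j then 1 else 0

/-- The row `X_{i,j} σ_m` of the Lawrence–Krammer matrix of `σ m`. -/
def lkRow (k m i j : ℕ) : Pair k → Λ :=
  if m + 1 = i then X k m j
  else if i < m ∧ m + 1 = j then X k i m
  else if m = i ∧ m + 1 = j then (-t * q ^ 2) • X k i j
  else if m = i then
    q • X k (i + 1) j + (1 - q) • X k i j + (t * q * (1 - q)) • X k i (i + 1)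
  else if m = j then
    q • X k i (j + 1) + (1 - q) • X k i j - (q * (1 - q)) • X k j (j + 1)
  else X k i j

/-- The Lawrence–Krammer matrix of `σ m`. -/
def lkMat {k : ℕ} (m : Fin (k + 1)) : Matrix (Pair k) (Pair k) Λ :=
  Matrix.of fun p => lkRow k m p.1.1 p.1.2

/-- The rows of the inverse of the Lawrence–Krammer matrix of `σ m`. -/
def lkInvRow (k m i j : ℕ) : Pair k → Λ :=
  if m = i ∧ m + 1 = j then (-tinv * qinv ^ 2) • X k i j
  else if m = i then X k (i + 1) j
  else if m = j then X k i (j + 1)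
  else if m + 1 = i then
    qinv • X k m j + (1 - qinv) • X k i j - (qinv * (1 - qinv)) • X k m i
  else if i < m ∧ m + 1 = j then
    qinv • X k i m + (1 - qinv) • X k i j + (tinv * qinv * (1 - qinv)) • X k m j
  else X k i j

def lkInvMat {k : ℕ} (m : Fin (k + 1)) : Matrix (Pair k) (Pair k) Λ :=
  Matrix.of fun p => lkInvRow k m p.1.1 p.1.2

theorem X_eq_single {k : ℕ} (p : Pair k) : X k p.1.1 p.1.2 = Pi.single p 1 := by
  funext r
  simp only [X, Pi.single_apply]
  congr 1
  apply propext
  constructor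
  · rintro ⟨h1, h2⟩
    exact Subtype.ext (Prod.ext (Fin.ext h1) (Fin.ext h2))
  · rintro rfl; exact ⟨rfl, rfl⟩

theorem X_vecMul {k i j : ℕ} (f : ℕ → ℕ → Pair k → Λ) (hi : i < j) (hj : j < k + 2) :
    X k i j ᵥ* (Matrix.of fun p : Pair k => f p.1.1 p.1.2) = f i j := by
  have := X_eq_single (k := k) ⟨(⟨i, by omega⟩, ⟨j, hj⟩), hi⟩
  simp only at this
  rw [this, Matrix.single_one_vecMul]
  rfl

theorem mat_ext {k : ℕ} {M N : Matrix (Pair k) (Pair k) Λ}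
    (h : ∀ i j : ℕ, i < j → j < k + 2 → X k i j ᵥ* M = X k i j ᵥ* N) : M = N := by
  refine Matrix.ext fun p r => ?_
  have := congrFun (h p.1.1 p.1.2 p.2 p.1.2.2) r
  rw [X_eq_single, Matrix.single_one_vecMul, Matrix.single_one_vecMul] at this
  exact this

theorem X_lk {k i j : ℕ} (m : Fin (k + 1)) (hi : i < j) (hj : j < k + 2) :
    X k i j ᵥ* lkMat m = lkRow k m i j := X_vecMul (lkRow k m) hi hj

theorem X_lkInv {k i j : ℕ} (m : Fin (k + 1)) (hi : i < j) (hj : j < k + 2) :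
    X k i j ᵥ* lkInvMat m = lkInvRow k m i j := X_vecMul (lkInvRow k m) hi hj

theorem X_lk_left {k i j : ℕ} (m : Fin (k + 1)) (hi : i < j) (hj : j < k + 2)
    (h : m.val + 1 = i) : X k i j ᵥ* lkMat m = X k m j := by
  rw [X_lk m hi hj, lkRow, if_pos h]

theorem X_lk_right {k i j : ℕ} (m : Fin (k + 1)) (hi : i < j) (hj : j < k + 2)
    (h : i < m.val) (h' : m.val + 1 = j) : X k i j ᵥ* lkMat m = X k i m := by
  rw [X_lk m hi hj, lkRow, if_neg (by omega), if_pos ⟨h, h'⟩]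

theorem X_lk_self {k i j : ℕ} (m : Fin (k + 1)) (hi : i < j) (hj : j < k + 2)
    (h : m.val = i) (h' : m.val + 1 = j) :
    X k i j ᵥ* lkMat m = (-t * q ^ 2) • X k i j := by
  rw [X_lk m hi hj, lkRow, if_neg (by omega), if_neg (by omega), if_pos ⟨h, h'⟩]

theorem X_lk_fst {k i j : ℕ} (m : Fin (k + 1)) (hi : i < j) (hj : j < k + 2)
    (h : m.val = i) (h' : i + 1 < j) :
    X k i j ᵥ* lkMat m =
      q • X k (i + 1) j + (1 - q) • X k i j + (t * q * (1 - q)) • X k i (i + 1) := by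
  rw [X_lk m hi hj, lkRow, if_neg (by omega), if_neg (by omega), if_neg (by omega), if_pos h]

theorem X_lk_snd {k i j : ℕ} (m : Fin (k + 1)) (hi : i < j) (hj : j < k + 2)
    (h : m.val = j) :
    X k i j ᵥ* lkMat m =
      q • X k i (j + 1) + (1 - q) • X k i j - (q * (1 - q)) • X k j (j + 1) := by
  rw [X_lk m hi hj, lkRow, if_neg (by omega), if_neg (by omega), if_neg (by omega),
    if_neg (by omega), if_pos h]

theorem X_lk_far {k i j : ℕ} (m : Fin (k + 1)) (hi : i < j) (hj : j < k + 2)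
    (h1 : m.val + 1 ≠ i) (h2 : m.val + 1 ≠ j) (h3 : m.val ≠ i) (h4 : m.val ≠ j) :
    X k i j ᵥ* lkMat m = X k i j := by
  rw [X_lk m hi hj, lkRow, if_neg (by omega), if_neg (by omega), if_neg (by omega),
    if_neg (by omega), if_neg (by omega)]

theorem lkMat_mul_lkInvMat {k : ℕ} (m : Fin (k + 1)) : lkMat m * lkInvMat m = 1 := by
  refine mat_ext fun i j hi hj => ?_
  have ht := t_mul_tinv
  have hq := q_mul_qinv
  have hm := m.2
  rw [← vecMul_vecMul, X_lk m hi hj, vecMul_one, lkRow]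
  split_ifs <;>
  simp (disch := omega) only [add_vecMul, sub_vecMul, smul_vecMul, X_lkInv] <;>
  simp only [lkInvRow] <;>
  split_ifs <;> first | omega | skip
  all_goals try rfl
  all_goals
    obtain ⟨m, hm'⟩ := m
    simp only at *
    try casesm* _ ∧ _
    subst_vars
    first | rfl | (match_scalars <;> grind)

theorem lkMat_far {k : ℕ} (a b : Fin (k + 1)) (h : a.val + 1 < b.val) :
    lkMat a * lkMat b = lkMat b * lkMat a := by
  refine mat_ext fun i j hi hj => ?_
  have hb := b.2
  rw [← vecMul_vecMul, ← vecMul_vecMul, X_lk a hi hj, X_lk b hi hj]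
  simp only [lkRow]
  split_ifs <;> first | omega | skip
  all_goals simp (disch := omega) only [add_vecMul, sub_vecMul, smul_vecMul, X_lk_left,
      X_lk_right, X_lk_self, X_lk_fst, X_lk_snd, X_lk_far]
  all_goals
    obtain ⟨a, ha'⟩ := a
    obtain ⟨b, hb'⟩ := b
    simp only at *
    try casesm* _ ∧ _
    subst_vars
    module

theorem lkMat_braid {k : ℕ} (a b : Fin (k + 1)) (h : a.val + 1 = b.val) :
    lkMat a * lkMat b * lkMat a = lkMat b * lkMat a * lkMat b := by
  refine mat_ext fun i j hi hj => ?_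
  have hb := b.2
  simp only [← vecMul_vecMul]
  rw [X_lk a hi hj, X_lk b hi hj]
  simp only [lkRow]
  split_ifs <;> first | omega | skip
  all_goals simp (disch := omega) only [add_vecMul, sub_vecMul, smul_vecMul, X_lk_left,
      X_lk_right, X_lk_self, X_lk_fst, X_lk_snd, X_lk_far]
  all_goals
    obtain ⟨a, ha'⟩ := a
    obtain ⟨b, hb'⟩ := b
    simp only at *
    try casesm* _ ∧ _
    subst_vars
    module

/-- The Lawrence–Krammer matrix of `σ m` as an invertible matrix. -/
def lkUnit {k : ℕ} (m : Fin (k + 1)) : (Matrix (Pair k) (Pair k) Λ)ˣ where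
  val := lkMat m
  inv := lkInvMat m
  val_inv := lkMat_mul_lkInvMat m
  inv_val := mul_eq_one_comm.1 (lkMat_mul_lkInvMat m)

/-- The Lawrence–Krammer representation `𝓚 : B_n → GL(n(n-1)/2, Λ)`, `n = k + 2`, acting on row
vectors from the right. -/
def lkRep (k : ℕ) : Braid (k + 1) →* (Matrix (Pair k) (Pair k) Λ)ˣ :=
  braidLift lkUnit (fun i j h => Units.ext (lkMat_far i j h))
    (fun i j h => Units.ext (lkMat_braid i j h))

/-- The Lawrence–Krammer matrix `𝓚(β)`. -/
def K {k : ℕ} (β : Braid (k + 1)) : Matrix (Pair k) (Pair k) Λ := (lkRep k β).val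

theorem K_mul {k : ℕ} (β γ : Braid (k + 1)) : K (β * γ) = K β * K γ := by
  simp [K]

theorem K_σ {k : ℕ} (m : Fin (k + 1)) : K (σ m) = lkMat m := by
  simp [K, lkRep, braidLift_σ, lkUnit]

/-! ### The matrix algebra of biforks -/

/-- The matrix `X*_{1,2} X_{1,2} = -𝓚(σ_1) + q 𝓚(σ_1⁻¹) + (1 - q) I`. -/
def E (k : ℕ) : Matrix (Pair k) (Pair k) Λ :=
  -K (σ 0) + q • K (σ 0)⁻¹ + (1 - q) • 1

/-- The biforks `𝓚(β) X*_{1,2} X_{1,2} 𝓚(γ)`. -/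
def bifork {k : ℕ} (β γ : Braid (k + 1)) : Matrix (Pair k) (Pair k) Λ := K β * E k * K γ

theorem bifork_mul_bifork {k : ℕ} (β γ β' γ' : Braid (k + 1)) :
    bifork β γ * bifork β' γ' = -bifork β (γ * β' * σ 0 * γ') +
      q • bifork β (γ * β' * (σ 0)⁻¹ * γ') + (1 - q) • bifork β (γ * β' * γ') := by
  have h : bifork β' γ' = -K (β' * σ 0 * γ') + q • K (β' * (σ 0)⁻¹ * γ') +
      (1 - q) • K (β' * γ') := by
    simp only [bifork, E, K_mul, mul_add, add_mul, Matrix.mul_neg, Matrix.neg_mul,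
      mul_smul_comm, smul_mul_assoc, mul_one]
  rw [h]
  simp only [bifork, K_mul, mul_add, Matrix.mul_neg, mul_smul_comm, mul_assoc]

/-- The matrix algebra `𝓜_n` of biforks, `n = k + 2`: the `Λ`-span of all biforks, as a (not
necessarily unital) subalgebra of the full matrix algebra. -/
def MAlg (k : ℕ) : NonUnitalSubalgebra Λ (Matrix (Pair k) (Pair k) Λ) where
  __ := Submodule.span Λ {M | ∃ β γ : Braid (k + 1), M = bifork β γ}
  mul_mem' := by
    intro a b ha hb
    simp only [AddSubsemigroup.mem_carrier, AddSubmonoid.mem_toSubsemigroup,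
      Submodule.mem_toAddSubmonoid] at ha hb ⊢
    induction ha, hb using Submodule.span_induction₂ with
    | mem_mem x y hx hy =>
      obtain ⟨β, γ, rfl⟩ := hx
      obtain ⟨β', γ', rfl⟩ := hy
      rw [bifork_mul_bifork]
      exact add_mem (add_mem (neg_mem (Submodule.subset_span ⟨_, _, rfl⟩))
        (Submodule.smul_mem _ _ (Submodule.subset_span ⟨_, _, rfl⟩)))
        (Submodule.smul_mem _ _ (Submodule.subset_span ⟨_, _, rfl⟩))
    | zero_left y hy => simp
    | zero_right x hx => simp
    | add_left x y z _ _ _ h1 h2 => rw [add_mul]; exact add_mem h1 h2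
    | add_right x y z _ _ _ h1 h2 => rw [mul_add]; exact add_mem h1 h2
    | smul_left r x y _ _ h => rw [smul_mul_assoc]; exact Submodule.smul_mem _ _ h
    | smul_right r x y _ _ h => rw [mul_smul_comm]; exact Submodule.smul_mem _ _ h

/-- The standard bifork `X*_{i,j} X_{u,v}`, where `p = (i,j)` and `r = (u,v)`. -/
def stdBifork {k : ℕ} (p r : Pair k) : MAlg k :=
  ⟨bifork (permBraid p.1.1 p.1.2) (permBraid r.1.1 r.1.2)⁻¹,
    Submodule.subset_span ⟨_, _, rfl⟩⟩

/-! ### Geometric biforks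

A geometric bifork on `n = k + 2` strings has a single local minimum, where the two upper tines
meet, and a single local maximum, where the two lower tines meet; the handle descends from the
minimum to the maximum, and nothing else turns around.  Cutting just above the minimum and just
below the maximum leaves a braid on `n` strings, a braid on `n - 1` strings one of which is the
handle, and another braid on `n` strings. -/

/-- A geometric bifork, cut at the heights of its two vertices. -/
structure BiforkPicture (k : ℕ) where
  /-- the braid above the minimum -/
  above : Braid (k + 1)
  /-- The upper tines arrive at the minimum in positions `cup` and `cup + 1`; the handle leaves
  it as the strand in position `cup` of `middle`. -/
  cup : Fin (k + 1)
  /-- the braid between the two vertices, the handle being one of its strands -/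
  middle : Braid k
  /-- the braid below the maximum; the lower tines leave the maximum in the positions `c` and
  `c + 1`, where `c` is the bottom position of the handle in `middle` -/
  below : Braid (k + 1)

/-- The braid obtained from the crossing `σ i` on `n - 1` strands by doubling the strand that
starts in position `h` (that is, replacing the handle by two parallel tines). -/
def double {k : ℕ} (h : Fin (k + 1)) (i : Fin k) : Braid (k + 1) :=
  if i.val = h.val then σ i.succ * σ i.castSucc
  else if i.val + 1 = h.val then σ i.castSucc * σ i.succ
  else if i.val < h.val then σ i.castSucc
  else σ i.succ

/-- The isotopies between pictures that change the braids at the two vertices: a crossing that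
takes place below the minimum (above the maximum) may be moved across it, a string that crosses
the handle then crossing both tines on the same side; and a half twist of the upper tines may be
pushed along the handle to the lower tines.  (Vertices and handle are flat bands: a half twist of
two tines is not removable by an isotopy.) -/
inductive Isotopy (k : ℕ) : BiforkPicture k → BiforkPicture k → Prop
  | cup (u : Braid (k + 1)) (h : Fin (k + 1)) (i : Fin k) (m : Braid k) (l : Braid (k + 1)) :
      Isotopy k ⟨u, h, σ i * m, l⟩ ⟨u * double h i, trace h (σ i), m, l⟩
  | cap (u : Braid (k + 1)) (h : Fin (k + 1)) (m : Braid k) (i : Fin k) (l : Braid (k + 1)) :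
      Isotopy k ⟨u, h, m * σ i, l⟩ ⟨u, h, m, double (trace h m) i * l⟩
  | twist (u : Braid (k + 1)) (h : Fin (k + 1)) (m : Braid k) (l : Braid (k + 1)) :
      Isotopy k ⟨u * σ h, h, m, l⟩ ⟨u, h, m, σ (trace h m) * l⟩

/-- Geometric biforks on `k + 2` strings, up to isotopy. -/
def GeomBifork (k : ℕ) : Type := Quot (Isotopy k)

/-- The simple geometric bifork `x*_{1,2} x_{1,2}` with the braid `β` attached to its top and the
braid `γ` attached to its bottom. -/
def attach {k : ℕ} (β γ : Braid (k + 1)) : GeomBifork k := Quot.mk _ ⟨β, 0, 1, γ⟩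

/-! ### The skein algebra -/

/-- The generator of the free algebra on all geometric biforks given by a picture. -/
def gen {k : ℕ} (u : Braid (k + 1)) (h : Fin (k + 1)) (m : Braid k) (l : Braid (k + 1)) :
    FreeAlgebra Λ (GeomBifork k) :=
  FreeAlgebra.ι Λ (Quot.mk _ ⟨u, h, m, l⟩ : GeomBifork k)

/-- The relations of the skein algebra.  In all relations but `concat` arbitrary braids `b` and
`c` are attached to the local pictures at the top and at the bottom. -/
inductive SkeinRel (k : ℕ) :
    FreeAlgebra Λ (GeomBifork k) → FreeAlgebra Λ (GeomBifork k) → Prop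
  /-- Multiplication is concatenation: a braid between two biforks may be regarded as a part of
  the upper or of the lower one. -/
  | concat (u h m l b u' h' m' l') :
      SkeinRel k (gen u h m (l * b) * gen u' h' m' l') (gen u h m l * gen (b * u') h' m' l')
  /-- Relation `(crossing) - q (inverse crossing) = (1 - q) (no crossing) - (simple bifork)`, at
  a crossing of a bifork above its minimum. -/
  | resolve_above (b i u h m l) :
      SkeinRel k (gen (b * σ i * u) h m l - q • gen (b * (σ i)⁻¹ * u) h m l)
        ((1 - q) • gen (b * u) h m l - gen b i 1 1 * gen u h m l)
  /-- The same at a crossing of a bifork below its maximum. -/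
  | resolve_below (u h m l i c) :
      SkeinRel k (gen u h m (l * σ i * c) - q • gen u h m (l * (σ i)⁻¹ * c))
        ((1 - q) • gen u h m (l * c) - gen u h m l * gen 1 i 1 c)
  /-- A half twist of the tines. -/
  | half_twist (b h c) :
      SkeinRel k (gen b h 1 (σ h * c)) ((-t * q ^ 2) • gen b h 1 c)
  /-- A crossing of two strings next to the handle may be removed. -/
  | crossing_beside (b h c) (i : Fin k) (h1 : i.val ≠ h.val) (h2 : i.val + 1 ≠ h.val) :
      SkeinRel k (gen b h (σ i) c) (gen b h 1 c)
  /-- Two simple biforks that have no strings in common. -/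
  | disjoint (b h h' c) (hh : h.val + 1 < h'.val ∨ h'.val + 1 < h.val) :
      SkeinRel k (gen b h 1 1 * gen 1 h' 1 c) 0
  /-- A string going once around the handle. -/
  | handle_loop (b h c) (i : Fin k) (h1 : i.val = h.val ∨ i.val + 1 = h.val) :
      SkeinRel k (gen b h (σ i * σ i) c) (q ^ 2 • gen b h 1 c)
  /-- Two simple biforks that share one string, the upper one on the left: the handle crosses
  that string once, from left to right. -/
  | exchange_right (b c) (i : Fin k) :
      SkeinRel k (gen b i.castSucc 1 1 * gen 1 i.succ 1 c)
        ((q * (1 - q)) • gen b i.castSucc (σ i)⁻¹ c)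
  /-- Two simple biforks that share one string, the upper one on the right: the handle crosses
  that string once, from right to left. -/
  | exchange_left (b c) (i : Fin k) :
      SkeinRel k (gen b i.succ 1 1 * gen 1 i.castSucc 1 c)
        ((q * (1 - q)) • gen b i.succ (σ i)⁻¹ c)

/-- The class of a geometric bifork modulo the skein relations. -/
def skeinClass {k : ℕ} (g : GeomBifork k) : RingQuot (SkeinRel k) :=
  RingQuot.mkAlgHom Λ (SkeinRel k) (FreeAlgebra.ι Λ g)

/-- The skein algebra `𝓣_n` of geometric biforks, `n = k + 2`: the (not necessarily unital)
`Λ`-algebra generated by the geometric biforks with the skein relations.  All relations have zero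
constant term, so this is the part without constant term of the unital algebra with the same
generators and relations. -/
def TAlg (k : ℕ) : NonUnitalSubalgebra Λ (RingQuot (SkeinRel k)) :=
  NonUnitalAlgebra.adjoin Λ (Set.range skeinClass)

/-- The standard geometric bifork `x*_{i,j} x_{u,v}`, where `p = (i,j)` and `r = (u,v)`. -/
def stdGeomBifork {k : ℕ} (p r : Pair k) : TAlg k :=
  ⟨skeinClass (attach (permBraid p.1.1 p.1.2) (permBraid r.1.1 r.1.2)⁻¹),
    NonUnitalAlgebra.subset_adjoin Λ (Set.mem_range_self _)⟩

end

end LKBifork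

/-!
The isomorphism is induced by a representation of the skein algebra by matrices.  The matrix
`biforkAt h = -𝓚(σ_h) + q 𝓚(σ_h⁻¹) + (1 - q)` has rank one: it is the product of a column
`adjCofork h` and the row `adjFork h`, which is the fork `X_{h,h+1}` (`biforkAt_eq`).  Doubling a
strand of a crossing intertwines these rows and columns up to a power of `q ^ 2`
(`adjFork_vecMul_K_double`, `K_double_mulVec_adjCofork`).  So the braid between the two vertices of
a geometric bifork matters only through the end point of the handle and a scalar cocycle
(`handleScalar`), and a geometric bifork has a well-defined matrix (`pictureMat_isotopy`), which
satisfies the skein relations (`freeMat_rel`).  The biforks of the form `attach β γ` are sent to the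
matrices `bifork β γ`, so the image is the whole matrix algebra.

For injectivity, the standard geometric biforks span the skein algebra
(`mem_span_std_of_mem_TAlg`).  Isotopies reduce every geometric bifork to one of the form
`attach β γ`, and the resolution of a crossing turns a product of two of these into a linear
combination of them.  It remains to reduce `β` and `γ` to standard braids.  A generator `σ_m` or its
inverse takes `A_{i,j} = (σ_{i-1} ⋯ σ_0)(σ_{j-1} ⋯ σ_1)` to another such braid, up to a braid that
the simple bifork absorbs, except when the crossing has the wrong sign; in that case the resolution
of the crossing leaves a product of a simple bifork with a standard one, and the exchange relations
identify it with a multiple of a single standard bifork (`simple_mul_fst`, `simple_mul_snd` and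
their mirror images `fst_mul_simple`, `snd_mul_simple`).  The bookkeeping common to the upper and
the lower half is `mem_span_pairBraid`.

Finally the images of the standard geometric biforks are linearly independent.  Their rows are the
unit vectors (`X_vecMul_pairBraid_inv`), and their columns form a square matrix which becomes
`t - t⁻¹` times the identity at `q = 1`, so that its determinant is not zero
(`coforkMat_det_ne_zero`).
-/

open Matrix

namespace LKBifork

noncomputable section

/-! ### The matrix of a simple bifork -/

theorem K_one {k : ℕ} : K (1 : Braid (k + 1)) = 1 := by simp [K]

theorem K_σ_inv {k : ℕ} (m : Fin (k + 1)) : K (σ m)⁻¹ = lkInvMat m := by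
  simp [K, lkRep, braidLift_σ, lkUnit]

/-- The matrix `-𝓚(σ_h) + q 𝓚(σ_h⁻¹) + (1 - q) I` of the simple bifork at position `h`. -/
def biforkAt {k : ℕ} (h : Fin (k + 1)) : Matrix (Pair k) (Pair k) Λ :=
  -lkMat h + q • lkInvMat h + (1 - q) • 1

/-- The index `(h, h + 1)`. -/
def adjPair {k : ℕ} (h : Fin (k + 1)) : Pair k := ⟨(h.castSucc, h.succ), h.castSucc_lt_succ⟩

/-- The standard fork `X_{h,h+1}`. -/
def adjFork {k : ℕ} (h : Fin (k + 1)) : Pair k → Λ := X k h (h + 1)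

theorem adjFork_eq_single {k : ℕ} (h : Fin (k + 1)) : adjFork h = Pi.single (adjPair h) 1 := by
  rw [← X_eq_single]; rfl

/-- The column `X*_{h,h+1}`, for which `biforkAt h` is the product of `X*_{h,h+1}` and
`X_{h,h+1}`. -/
def adjCofork {k : ℕ} (h : Fin (k + 1)) : Pair k → Λ := fun p => biforkAt h p (adjPair h)

/-- The scalar by which `X_{i,j}` pairs with `X*_{h,h+1}`. -/
def pairing (h i j : ℕ) : Λ :=
  if h = i ∧ h + 1 = j then t * q ^ 2 - tinv * qinv + (1 - q)
  else if h = i then -(t * q * (1 - q))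
  else if h = j then q * (1 - q)
  else if h + 1 = i then -(1 - qinv)
  else if i < h ∧ h + 1 = j then tinv * (1 - qinv)
  else 0

theorem X_biforkAt {k i j : ℕ} (h : Fin (k + 1)) (hi : i < j) (hj : j < k + 2) :
    X k i j ᵥ* biforkAt h = pairing h i j • adjFork h := by
  have ht := t_mul_tinv
  have hq := q_mul_qinv
  have hm := h.2
  rw [biforkAt, vecMul_add, vecMul_add, vecMul_neg, vecMul_smul, vecMul_smul, X_lk h hi hj,
    X_lkInv h hi hj, vecMul_one, adjFork, pairing]
  obtain ⟨m, hm'⟩ := h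
  simp only [lkRow, lkInvRow]
  split_ifs <;> first | omega | skip
  all_goals
    simp only at *
    try casesm* _ ∧ _
    subst_vars
    match_scalars <;> grind

theorem biforkAt_eq {k : ℕ} (h : Fin (k + 1)) :
    biforkAt h = vecMulVec (adjCofork h) (adjFork h) := by
  ext p r
  have := X_biforkAt h p.2 p.1.2.2
  rw [X_eq_single, Matrix.single_one_vecMul] at this
  have h1 := congrFun this r
  have h2 := congrFun this (adjPair h)
  simp only [Matrix.row, Pi.smul_apply, smul_eq_mul] at h1 h2
  rw [vecMulVec_apply, h1, adjCofork, h2, adjFork_eq_single, Pi.single_eq_same, mul_one]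

theorem adjCofork_apply {k : ℕ} (h : Fin (k + 1)) (p : Pair k) :
    adjCofork h p = pairing h p.1.1 p.1.2 := by
  have := X_biforkAt h p.2 p.1.2.2
  rw [X_eq_single, Matrix.single_one_vecMul] at this
  have h2 := congrFun this (adjPair h)
  simp only [Matrix.row, Pi.smul_apply, smul_eq_mul] at h2
  rw [adjCofork, h2, adjFork_eq_single, Pi.single_eq_same, mul_one]

theorem adjFork_dotProduct {k : ℕ} (h h' : Fin (k + 1)) :
    adjFork h ⬝ᵥ adjCofork h' = pairing h' h (h + 1) := by
  rw [adjFork_eq_single, single_one_dotProduct, adjCofork_apply]; rfl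

theorem adjFork_vecMul_K_self {k : ℕ} (h : Fin (k + 1)) :
    adjFork h ᵥ* K (σ h) = (-t * q ^ 2) • adjFork h := by
  rw [K_σ, adjFork, X_lk_self h (by omega) (by omega) rfl rfl]

theorem adjFork_vecMul_K_right {k : ℕ} (h h' : Fin (k + 1)) (hh : h'.val = h + 1) :
    adjFork h ᵥ* K (σ h' * σ h) = q ^ 2 • adjFork h' := by
  have := h'.2
  rw [K_mul, K_σ, K_σ, ← vecMul_vecMul, adjFork, adjFork]
  simp (disch := omega) only [add_vecMul, sub_vecMul, smul_vecMul, X_lk_left, X_lk_self, X_lk_fst,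
    X_lk_snd]
  simp only [hh]
  match_scalars <;> ring

theorem adjFork_vecMul_K_left {k : ℕ} (h h' : Fin (k + 1)) (hh : h'.val = h + 1) :
    adjFork h' ᵥ* K (σ h * σ h') = adjFork h := by
  have := h'.2
  rw [K_mul, K_σ, K_σ, ← vecMul_vecMul, adjFork, adjFork]
  simp (disch := omega) only [X_lk_left, X_lk_right, hh]

theorem adjFork_vecMul_K_far {k : ℕ} (h j : Fin (k + 1)) (hj : h.val + 1 < j ∨ j.val + 1 < h) :
    adjFork h ᵥ* K (σ j) = adjFork h := by
  rw [K_σ, adjFork, X_lk_far j (by omega) (by omega) (by omega) (by omega) (by omega) (by omega)]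

/-! ### Strands and doubled strands in the braid group -/

theorem braid_induction {s : ℕ} {P : Braid s → Prop} (one : P 1)
    (mul : ∀ i m, P m → P (σ i * m)) (inv_mul : ∀ i m, P m → P ((σ i)⁻¹ * m)) (m : Braid s) :
    P m := by
  have hm : m ∈ Subgroup.closure (Set.range (PresentedGroup.of (rels := {r | ArtinRel s r}))) := by
    rw [PresentedGroup.closure_range_of]; trivial
  induction hm using Subgroup.closure_induction_left with
  | one => exact one
  | mul_left x hx y _ ih => obtain ⟨i, rfl⟩ := hx; exact mul i y ih
  | inv_mul_cancel x hx y _ ih => obtain ⟨i, rfl⟩ := hx; exact inv_mul i y ih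

theorem σ_commute {s : ℕ} (i j : Fin s) (h : i.val + 1 < j.val ∨ j.val + 1 < i.val) :
    σ i * σ j = σ j * σ i := by
  have key : ∀ i j : Fin s, i.val + 1 < j.val → σ i * σ j = σ j * σ i := by
    intro i j h
    have := PresentedGroup.one_of_mem (rels := {r | ArtinRel s r}) (ArtinRel.far i j h)
    simp only [map_mul, map_inv] at this
    exact mul_inv_eq_one.1 this
  rcases h with h | h
  · exact key i j h
  · exact (key j i h).symm

theorem σ_braid {s : ℕ} (i j : Fin s) (h : i.val + 1 = j.val) :
    σ i * σ j * σ i = σ j * σ i * σ j := by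
  have := PresentedGroup.one_of_mem (rels := {r | ArtinRel s r}) (ArtinRel.braid i j h)
  simp only [map_mul, map_inv] at this
  exact mul_inv_eq_one.1 this

theorem trace_one {s : ℕ} (h : Fin (s + 1)) : trace h 1 = h := by simp [trace]

theorem trace_mul {s : ℕ} (h : Fin (s + 1)) (m m' : Braid s) :
    trace h (m * m') = trace (trace h m) m' := by simp [trace]

theorem braidPerm_σ {s : ℕ} (i : Fin s) : braidPerm s (σ i) = adjSwap i := braidLift_σ _ _ _ _

theorem trace_σ {s : ℕ} (h : Fin (s + 1)) (i : Fin s) : trace h (σ i) = adjSwap i h := by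
  rw [trace, braidPerm_σ, adjSwap, Equiv.swap_inv]

theorem trace_σ_castSucc {s : ℕ} (i : Fin s) : trace i.castSucc (σ i) = i.succ := by
  simp [trace_σ, adjSwap]

theorem trace_σ_succ {s : ℕ} (i : Fin s) : trace i.succ (σ i) = i.castSucc := by
  simp [trace_σ, adjSwap]

theorem trace_σ_far {s : ℕ} (h : Fin (s + 1)) (i : Fin s) (h1 : i.val ≠ h) (h2 : i.val + 1 ≠ h) :
    trace h (σ i) = h := by
  rw [trace_σ, adjSwap, Equiv.swap_apply_of_ne_of_ne] <;>
  · rintro rfl; simp at h1 h2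

theorem handle_cases {s : ℕ} (h : Fin (s + 1)) (i : Fin s) :
    h = i.castSucc ∨ h = i.succ ∨ (i.val ≠ h ∧ i.val + 1 ≠ h) := by
  simp only [Fin.ext_iff, Fin.val_castSucc, Fin.val_succ]; omega

theorem double_castSucc {k : ℕ} (i : Fin k) :
    double i.castSucc i = σ i.succ * σ i.castSucc := by simp [double]

theorem double_succ {k : ℕ} (i : Fin k) :
    double i.succ i = σ i.castSucc * σ i.succ := by simp [double]

theorem double_far {k : ℕ} (h : Fin (k + 1)) (i : Fin k) (h1 : i.val ≠ h) (h2 : i.val + 1 ≠ h) :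
    ∃ j : Fin (k + 1), double h i = σ j ∧ (h.val + 1 < j ∨ j.val + 1 < h) := by
  by_cases hi : i.val < h
  · exact ⟨i.castSucc, by simp [double, h1, h2, hi], by simp; omega⟩
  · exact ⟨i.succ, by simp [double, h1, h2, hi], by simp; omega⟩

/-- A half twist of the tines slides along the handle through a crossing. -/
theorem double_mul_σ {k : ℕ} (h : Fin (k + 1)) (i : Fin k) :
    double h i * σ (trace h (σ i)) = σ h * double h i := by
  have hb := σ_braid i.castSucc i.succ (by simp)
  rcases handle_cases h i with rfl | rfl | ⟨h1, h2⟩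
  · rw [double_castSucc, trace_σ_castSucc, ← mul_assoc, hb]
  · rw [double_succ, trace_σ_succ, ← mul_assoc, hb]
  · obtain ⟨j, hj, hj'⟩ := double_far h i h1 h2
    rw [hj, trace_σ_far h i h1 h2, σ_commute _ _ hj']

/-! ### The weight of the handle -/

theorem val_adjSwap {s : ℕ} (i : Fin s) (x : Fin (s + 1)) :
    (adjSwap i x).val =
      if x.val = i.val then i.val + 1 else if x.val = i.val + 1 then i.val else x.val := by
  simp only [adjSwap, Equiv.swap_apply_def, Fin.ext_iff, Fin.val_castSucc, Fin.val_succ]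
  split_ifs <;> simp

/-- The action of the crossing `σ i` on pairs of a position and an integer, read from bottom to top:
the strand at the given position is followed, and the integer drops by one if the upper end of that
strand is the left one of the two crossing strands. -/
def handlePerm {s : ℕ} (i : Fin s) : Equiv.Perm (Fin (s + 1) × ℤ) where
  toFun x := (adjSwap i x.1, x.2 - if x.1.val = i.val + 1 then 1 else 0)
  invFun x := (adjSwap i x.1, x.2 + if x.1.val = i.val then 1 else 0)
  left_inv x := by
    refine Prod.ext (by simp [adjSwap]) ?_
    simp only [val_adjSwap]
    split_ifs <;> omega
  right_inv x := by
    refine Prod.ext (by simp [adjSwap]) ?_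
    simp only [val_adjSwap]
    split_ifs <;> omega

theorem handlePerm_apply {s : ℕ} (i : Fin s) (x : Fin (s + 1) × ℤ) :
    handlePerm i x = (adjSwap i x.1, x.2 - if x.1.val = i.val + 1 then 1 else 0) := rfl

/-- The homomorphism given by the action of the crossings on positions and integers. -/
def handleAct (s : ℕ) : Braid s →* Equiv.Perm (Fin (s + 1) × ℤ) :=
  braidLift handlePerm
    (by
      intro i j h
      refine Equiv.ext fun ⟨x, e⟩ => ?_
      simp only [handlePerm_apply, Equiv.Perm.mul_apply, Prod.mk.injEq, Fin.ext_iff, val_adjSwap]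
      constructor <;> grind)
    (by
      intro i j h
      refine Equiv.ext fun ⟨x, e⟩ => ?_
      simp only [handlePerm_apply, Equiv.Perm.mul_apply, Prod.mk.injEq, Fin.ext_iff, val_adjSwap]
      constructor <;> grind)

theorem handleAct_σ {s : ℕ} (i : Fin s) : handleAct s (σ i) = handlePerm i :=
  braidLift_σ _ _ _ _

/-- The weight of the strand of `m` starting in position `h`: the number of crossings `σ i` at which
it goes down from left to right, minus the number of crossings `(σ i)⁻¹` at which it goes down from
right to left.  It is read off from `handleAct`, whose inverse follows strands downwards. -/
def weight {s : ℕ} (h : Fin (s + 1)) (m : Braid s) : ℤ := ((handleAct s m)⁻¹ (h, 0)).2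

theorem handleAct_inv_apply {s : ℕ} (m : Braid s) (h : Fin (s + 1)) (e : ℤ) :
    (handleAct s m)⁻¹ (h, e) = (trace h m, e + weight h m) := by
  have key : ∀ (m : Braid s) (h : Fin (s + 1)) (e : ℤ), (handleAct s m)⁻¹ (h, e) =
      (trace h m, e + ((handleAct s m)⁻¹ (h, 0)).2) := by
    intro m
    induction m using braid_induction with
    | one => intro h e; simp [trace_one]
    | mul i m ih =>
      intro h e
      rw [map_mul, _root_.mul_inv_rev, trace_mul, trace_σ, Equiv.Perm.mul_apply,
        Equiv.Perm.mul_apply]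
      have h1 : ∀ e, (handleAct s (σ i))⁻¹ (h, e) =
          (adjSwap i h, e + if h.val = i.val then 1 else 0) := by
        intro e; rw [handleAct_σ]; rfl
      rw [h1, h1, ih, ih _ (0 + _)]
      simp [add_assoc]
    | inv_mul i m ih =>
      intro h e
      have h2 : trace h (σ i)⁻¹ = adjSwap i h := by
        rw [trace, map_inv, inv_inv, braidPerm_σ]
      rw [map_mul, _root_.mul_inv_rev, trace_mul, h2, Equiv.Perm.mul_apply,
        Equiv.Perm.mul_apply]
      have h1 : ∀ e, (handleAct s (σ i)⁻¹)⁻¹ (h, e) =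
          (adjSwap i h, e - if h.val = i.val + 1 then 1 else 0) := by
        intro e; rw [map_inv, inv_inv, handleAct_σ]; rfl
      rw [h1, h1, ih, ih _ (0 - _)]
      simp only [zero_sub, Prod.mk.injEq, true_and]; ring
  exact key m h e

theorem weight_one {s : ℕ} (h : Fin (s + 1)) : weight h 1 = 0 := by simp [weight]

theorem weight_mul {s : ℕ} (h : Fin (s + 1)) (m m' : Braid s) :
    weight h (m * m') = weight h m + weight (trace h m) m' := by
  rw [weight, map_mul, _root_.mul_inv_rev, Equiv.Perm.mul_apply, handleAct_inv_apply m,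
    handleAct_inv_apply]
  simp

theorem weight_σ {s : ℕ} (h : Fin (s + 1)) (i : Fin s) :
    weight h (σ i) = if h = i.castSucc then 1 else 0 := by
  rw [weight, handleAct_σ]
  exact (zero_add _).trans (by simp [Fin.ext_iff])

/-- The unit `q` of `Λ`. -/
def qUnit : Λˣ := ⟨q, qinv, q_mul_qinv, by rw [mul_comm, q_mul_qinv]⟩

/-- The scalar by which the handle acts when it follows the strand of `m` starting in
position `h`. -/
def handleScalar {s : ℕ} (h : Fin (s + 1)) (m : Braid s) : Λ := ((qUnit ^ 2) ^ weight h m : Λˣ)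

theorem handleScalar_one {s : ℕ} (h : Fin (s + 1)) : handleScalar h 1 = 1 := by
  simp [handleScalar, weight_one]

theorem handleScalar_mul {s : ℕ} (h : Fin (s + 1)) (m m' : Braid s) :
    handleScalar h (m * m') = handleScalar h m * handleScalar (trace h m) m' := by
  simp [handleScalar, weight_mul, _root_.zpow_add]

theorem handleScalar_σ {s : ℕ} (h : Fin (s + 1)) (i : Fin s) :
    handleScalar h (σ i) = if h = i.castSucc then q ^ 2 else 1 := by
  rw [handleScalar, weight_σ]
  split_ifs <;> simp [qUnit]

/-- Doubling the handle in a crossing carries the fork at its top to the one at its bottom. -/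
theorem adjFork_vecMul_K_double {k : ℕ} (h : Fin (k + 1)) (i : Fin k) :
    adjFork h ᵥ* K (double h i) = handleScalar h (σ i) • adjFork (trace h (σ i)) := by
  rw [handleScalar_σ]
  rcases handle_cases h i with rfl | rfl | ⟨h1, h2⟩
  · rw [double_castSucc, trace_σ_castSucc, if_pos rfl, adjFork_vecMul_K_right _ _ (by simp)]
  · rw [double_succ, trace_σ_succ, if_neg i.castSucc_lt_succ.ne', one_smul,
      adjFork_vecMul_K_left _ _ (by simp)]
  · obtain ⟨j, hj, hj'⟩ := double_far h i h1 h2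
    rw [hj, trace_σ_far h i h1 h2, if_neg (by rintro rfl; simp at h1), one_smul,
      adjFork_vecMul_K_far _ _ hj']

theorem biforkAt_def {k : ℕ} (h : Fin (k + 1)) :
    biforkAt h = -K (σ h) + q • K (σ h)⁻¹ + (1 - q) • 1 := by
  rw [K_σ, K_σ_inv, biforkAt]

theorem adjCofork_eq_mulVec {k : ℕ} (h : Fin (k + 1)) :
    adjCofork h = biforkAt h *ᵥ Pi.single (adjPair h) 1 := by
  rw [mulVec_single_one]; rfl

theorem biforkAt_mulVec {k : ℕ} (h : Fin (k + 1)) (v : Pair k → Λ) :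
    biforkAt h *ᵥ v = (adjFork h ⬝ᵥ v) • adjCofork h := by
  ext p
  rw [biforkAt_eq, vecMulVec_mulVec]
  simp [mul_comm]

/-- A braid that conjugates `σ h'` to `σ h` carries the column of one bifork to a multiple of the
column of the other; the multiple is the one by which it acts on the rows. -/
theorem K_mulVec_adjCofork {k : ℕ} (h h' : Fin (k + 1)) (d : Braid (k + 1)) (s : Λ)
    (hd : d * σ h' = σ h * d) (hs : adjFork h ᵥ* K d = s • adjFork h') :
    K d *ᵥ adjCofork h' = s • adjCofork h := by
  have hd' : d * (σ h')⁻¹ = (σ h)⁻¹ * d := by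
    rw [mul_inv_eq_iff_eq_mul, mul_assoc, hd, inv_mul_cancel_left]
  have h1 : K d * biforkAt h' = biforkAt h * K d := by
    simp only [biforkAt_def, mul_add, add_mul, Matrix.mul_neg, Matrix.neg_mul, mul_smul_comm,
      smul_mul_assoc, ← K_mul, hd, hd', mul_one, one_mul]
  rw [adjCofork_eq_mulVec h', mulVec_mulVec, h1, ← mulVec_mulVec, biforkAt_mulVec,
    dotProduct_mulVec, hs, smul_dotProduct, adjFork_eq_single, single_one_dotProduct,
    Pi.single_eq_same, smul_eq_mul, mul_one]

theorem K_double_mulVec_adjCofork {k : ℕ} (h : Fin (k + 1)) (i : Fin k) :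
    K (double h i) *ᵥ adjCofork (trace h (σ i)) = handleScalar h (σ i) • adjCofork h :=
  K_mulVec_adjCofork _ _ _ _ (double_mul_σ h i) (adjFork_vecMul_K_double h i)

theorem K_self_mulVec_adjCofork {k : ℕ} (h : Fin (k + 1)) :
    K (σ h) *ᵥ adjCofork h = (-t * q ^ 2) • adjCofork h :=
  K_mulVec_adjCofork _ _ _ _ rfl (adjFork_vecMul_K_self h)

/-! ### The matrix of a picture -/

/-- The matrix of a geometric bifork: the column `X*_{h,h+1}` and the row `X_{h',h'+1}` at the two
ends of the handle, acted on by the braids above and below, times the scalar of the handle. -/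
def pictureMat {k : ℕ} (u : Braid (k + 1)) (h : Fin (k + 1)) (m : Braid k) (l : Braid (k + 1)) :
    Matrix (Pair k) (Pair k) Λ :=
  handleScalar h m • vecMulVec (K u *ᵥ adjCofork h) (adjFork (trace h m) ᵥ* K l)

theorem pictureMat_isotopy {k : ℕ} {P Q : BiforkPicture k} (h : Isotopy k P Q) :
    pictureMat P.above P.cup P.middle P.below = pictureMat Q.above Q.cup Q.middle Q.below := by
  cases h with
  | cup u h i m l =>
    simp only [pictureMat]
    rw [trace_mul, handleScalar_mul, K_mul, ← mulVec_mulVec, K_double_mulVec_adjCofork,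
      mulVec_smul, smul_vecMulVec, smul_smul, mul_comm]
  | cap u h m i l =>
    simp only [pictureMat]
    rw [trace_mul, handleScalar_mul, K_mul, ← vecMul_vecMul, adjFork_vecMul_K_double, smul_vecMul,
      vecMulVec_smul, smul_smul]
  | twist u h m l =>
    simp only [pictureMat]
    rw [K_mul, K_mul, ← mulVec_mulVec, ← vecMul_vecMul, adjFork_vecMul_K_self,
      K_self_mulVec_adjCofork, smul_vecMul, mulVec_smul, smul_vecMulVec, vecMulVec_smul]

/-- The matrix of an isotopy class of geometric biforks. -/
def geomMat {k : ℕ} : GeomBifork k → Matrix (Pair k) (Pair k) Λ :=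
  Quot.lift (fun P => pictureMat P.above P.cup P.middle P.below) fun _ _ => pictureMat_isotopy

/-- The extension of `geomMat` to the free algebra. -/
def freeMat (k : ℕ) : FreeAlgebra Λ (GeomBifork k) →ₐ[Λ] Matrix (Pair k) (Pair k) Λ :=
  FreeAlgebra.lift Λ geomMat

theorem freeMat_gen {k : ℕ} (u : Braid (k + 1)) (h : Fin (k + 1)) (m : Braid k)
    (l : Braid (k + 1)) : freeMat k (gen u h m l) = pictureMat u h m l :=
  FreeAlgebra.lift_ι_apply _ _

theorem pictureMat_eq {k : ℕ} (u : Braid (k + 1)) (h : Fin (k + 1)) (m : Braid k)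
    (l : Braid (k + 1)) : pictureMat u h m l =
      K u * (handleScalar h m • vecMulVec (adjCofork h) (adjFork (trace h m))) * K l := by
  rw [pictureMat, Matrix.mul_smul, mul_vecMulVec, Matrix.smul_mul, vecMulVec_mul]

theorem pictureMat_one {k : ℕ} (u : Braid (k + 1)) (h : Fin (k + 1)) (l : Braid (k + 1)) :
    pictureMat u h 1 l = K u * biforkAt h * K l := by
  rw [pictureMat_eq, handleScalar_one, trace_one, one_smul, biforkAt_eq]

theorem pictureMat_σ_mul {k : ℕ} (b c : Braid (k + 1)) (h : Fin (k + 1)) (s : Λ) (x : Braid (k+1))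
    (hs : adjFork h ᵥ* K x = s • adjFork h) :
    pictureMat b h 1 (x * c) = s • pictureMat b h 1 c := by
  rw [pictureMat, pictureMat, trace_one, K_mul, ← vecMul_vecMul, hs, smul_vecMul, vecMulVec_smul,
    smul_comm]

theorem K_resolve {k : ℕ} (b c : Braid (k + 1)) (i : Fin (k + 1)) :
    K (b * σ i * c) - q • K (b * (σ i)⁻¹ * c) = (1 - q) • K (b * c) - K b * biforkAt i * K c := by
  simp only [K_mul, biforkAt_def, mul_add, add_mul, Matrix.mul_neg, Matrix.neg_mul, mul_smul_comm,
    smul_mul_assoc, mul_one]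
  abel

/-- The product of two simple biforks is a bifork whose handle goes from the position of the first
to that of the second. -/
theorem pictureMat_mul {k : ℕ} (u : Braid (k + 1)) (h : Fin (k + 1)) (h' : Fin (k + 1))
    (l : Braid (k + 1)) : pictureMat u h 1 1 * pictureMat 1 h' 1 l =
      pairing h' h (h + 1) • vecMulVec (K u *ᵥ adjCofork h) (adjFork h' ᵥ* K l) := by
  rw [pictureMat, pictureMat, handleScalar_one, handleScalar_one, trace_one, trace_one, K_one,
    one_smul, one_smul, one_mulVec, vecMul_one, vecMulVec_mul_vecMulVec, adjFork_dotProduct,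
    vecMulVec_smul]

theorem handleScalar_inv {s : ℕ} (h : Fin (s + 1)) (i : Fin s) :
    handleScalar h (σ i) * handleScalar (trace h (σ i)) (σ i)⁻¹ = 1 := by
  rw [← handleScalar_mul, mul_inv_cancel, handleScalar_one]

theorem freeMat_rel {k : ℕ} {x y : FreeAlgebra Λ (GeomBifork k)} (h : SkeinRel k x y) :
    freeMat k x = freeMat k y := by
  cases h with
  | concat u h m l b u' h' m' l' =>
    simp only [map_mul, freeMat_gen, pictureMat_eq, K_mul, Matrix.mul_assoc]
  | resolve_above b i u h m l =>
    simp only [map_mul, map_sub, map_smul, freeMat_gen, pictureMat_one, K_one, mul_one]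
    simp only [pictureMat_eq]
    rw [← Matrix.mul_assoc, ← Matrix.mul_assoc, ← smul_mul_assoc, ← smul_mul_assoc, ← sub_mul,
      ← sub_mul, K_resolve, ← smul_mul_assoc, ← smul_mul_assoc, ← sub_mul, ← sub_mul]
  | resolve_below u h m l i c =>
    simp only [map_mul, map_sub, map_smul, freeMat_gen, pictureMat_one, K_one, one_mul]
    simp only [pictureMat_eq]
    rw [Matrix.mul_assoc _ (K l), ← Matrix.mul_assoc (K l), ← mul_smul_comm, ← mul_smul_comm,
      ← mul_sub, ← mul_sub, K_resolve]
  | half_twist b h c =>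
    rw [map_smul, freeMat_gen, freeMat_gen,
      pictureMat_σ_mul _ _ _ _ _ (adjFork_vecMul_K_self h)]
  | crossing_beside b h c i h1 h2 =>
    rw [freeMat_gen, freeMat_gen, pictureMat, pictureMat, trace_σ_far h i h1 h2, trace_one,
      handleScalar_σ, handleScalar_one, if_neg (by rintro rfl; simp at h1)]
  | disjoint b h h' c hh =>
    rw [map_mul, map_zero, freeMat_gen, freeMat_gen, pictureMat_mul, pairing, if_neg (by omega),
      if_neg (by omega), if_neg (by omega), if_neg (by omega), if_neg (by omega), zero_smul]
  | handle_loop b h c i h1 =>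
    rw [map_smul, freeMat_gen, freeMat_gen, pictureMat, pictureMat, trace_mul, handleScalar_mul,
      trace_one, handleScalar_one, one_smul, handleScalar_σ, handleScalar_σ]
    have : h = i.castSucc ∨ h = i.succ := by
      simp only [Fin.ext_iff, Fin.val_castSucc, Fin.val_succ]; omega
    rcases this with rfl | rfl
    · rw [trace_σ_castSucc, trace_σ_succ, if_pos rfl, if_neg i.castSucc_lt_succ.ne', mul_one]
    · rw [trace_σ_succ, trace_σ_castSucc, if_pos rfl, if_neg i.castSucc_lt_succ.ne', one_mul]
  | exchange_right b c i =>
    have h1 := handleScalar_inv i.succ i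
    rw [trace_σ_succ, handleScalar_σ, if_neg i.castSucc_lt_succ.ne', one_mul] at h1
    have h2 : trace i.castSucc (σ i)⁻¹ = i.succ := by
      rw [← trace_σ_succ i, ← trace_mul, mul_inv_cancel, trace_one]
    rw [map_mul, map_smul, freeMat_gen, freeMat_gen, freeMat_gen, pictureMat_mul, pictureMat, h1,
      h2, one_smul, pairing, if_neg (by simp), if_neg (by simp), if_pos (by simp)]
  | exchange_left b c i =>
    have h1 := handleScalar_inv i.castSucc i
    rw [trace_σ_castSucc, handleScalar_σ, if_pos rfl] at h1
    have h2 : trace i.succ (σ i)⁻¹ = i.castSucc := by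
      rw [← trace_σ_castSucc i, ← trace_mul, mul_inv_cancel, trace_one]
    have h3 : q * (1 - q) * handleScalar i.succ (σ i)⁻¹ = -(1 - qinv) := by
      have := q_mul_qinv
      grind
    rw [map_mul, map_smul, freeMat_gen, freeMat_gen, freeMat_gen, pictureMat_mul, pictureMat,
      h2, smul_smul, h3, pairing, if_neg (by simp), if_neg (by simp), if_neg (by simp; omega),
      if_pos (by simp)]

/-- The matrix representation of the skein algebra. -/
def skeinRep (k : ℕ) : RingQuot (SkeinRel k) →ₐ[Λ] Matrix (Pair k) (Pair k) Λ :=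
  RingQuot.liftAlgHom Λ ⟨freeMat k, fun _ _ h => freeMat_rel h⟩

theorem skeinRep_skeinClass {k : ℕ} (g : GeomBifork k) : skeinRep k (skeinClass g) = geomMat g := by
  rw [skeinRep, skeinClass, RingQuot.liftAlgHom_mkAlgHom_apply, freeMat, FreeAlgebra.lift_ι_apply]

theorem biforkAt_zero (k : ℕ) : biforkAt (0 : Fin (k + 1)) = E k := biforkAt_def 0

theorem skeinRep_attach {k : ℕ} (β γ : Braid (k + 1)) :
    skeinRep k (skeinClass (attach β γ)) = bifork β γ := by
  rw [skeinRep_skeinClass, bifork, ← biforkAt_zero, ← pictureMat_one]; rfl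

/-! ### Braids indexed by natural numbers -/

/-- The Artin generator `σ n`, with `n` a natural number; it is `1` if there is no such
generator. -/
def sg {s : ℕ} (n : ℕ) : Braid s := if h : n < s then σ ⟨n, h⟩ else 1

theorem sg_eq {s n : ℕ} (h : n < s) : (sg n : Braid s) = σ ⟨n, h⟩ := dif_pos h

theorem sg_comm {s : ℕ} (m n : ℕ) (h : m + 1 < n ∨ n + 1 < m) :
    (sg m * sg n : Braid s) = sg n * sg m := by
  unfold sg
  split_ifs with h1 h2
  · exact σ_commute _ _ h
  all_goals simp

theorem sg_braid {s : ℕ} (n : ℕ) (h : n + 1 < s) :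
    (sg n * sg (n + 1) * sg n : Braid s) = sg (n + 1) * sg n * sg (n + 1) := by
  rw [sg_eq h, sg_eq (by omega : n < s)]
  exact σ_braid _ _ rfl

/-- The braid `σ_{n-1} ⋯ σ_0`. -/
def down {s : ℕ} : ℕ → Braid s
  | 0 => 1
  | n + 1 => sg n * down n

/-- The braid `σ_n ⋯ σ_1`. -/
def downOne {s : ℕ} : ℕ → Braid s
  | 0 => 1
  | n + 1 => sg (n + 1) * downOne n

/-- The braid `(σ_{a-1} ⋯ σ_0)(σ_{b-1} ⋯ σ_1)` of `permBraid`, with natural numbers as indices; it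
takes the strands in positions `a < b` to the positions `0` and `1`. -/
def pairBraid {s : ℕ} (a b : ℕ) : Braid s := down a * downOne (b - 1)

theorem sg_mul_down_far {s : ℕ} (m n : ℕ) (h : n < m) :
    (sg m * down n : Braid s) = down n * sg m := by
  induction n with
  | zero => simp [down]
  | succ n ih => rw [down, ← mul_assoc, sg_comm m n (by omega), mul_assoc, ih (by omega), mul_assoc]

theorem sg_mul_downOne_far {s : ℕ} (m n : ℕ) (h : n + 1 < m) :
    (sg m * downOne n : Braid s) = downOne n * sg m := by
  induction n with
  | zero => simp [downOne]
  | succ n ih =>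
    rw [downOne, ← mul_assoc, sg_comm m (n + 1) (by omega), mul_assoc, ih (by omega), mul_assoc]

theorem sg_mul_down {s : ℕ} (m n : ℕ) (h : m + 1 < n) (hn : n ≤ s) :
    (sg m * down n : Braid s) = down n * sg (m + 1) := by
  induction n with
  | zero => omega
  | succ n ih =>
    rcases Nat.lt_or_ge (m + 1) n with h' | h'
    · rw [down, ← mul_assoc, sg_comm m n (by omega), mul_assoc, ih h' (by omega), mul_assoc]
    · obtain rfl : n = m + 1 := by omega
      rw [down, down, ← mul_assoc, ← mul_assoc, sg_braid m (by omega), mul_assoc _ (sg (m + 1)),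
        sg_mul_down_far _ _ (by omega)]
      simp only [mul_assoc]

theorem sg_mul_downOne {s : ℕ} (m n : ℕ) (h1 : 1 ≤ m) (h : m < n) (hn : n < s) :
    (sg m * downOne n : Braid s) = downOne n * sg (m + 1) := by
  induction n with
  | zero => omega
  | succ n ih =>
    rcases Nat.lt_or_ge m n with h' | h'
    · rw [downOne, ← mul_assoc, sg_comm m (n + 1) (by omega), mul_assoc, ih h' (by omega),
        mul_assoc]
    · obtain rfl : n = m := by omega
      obtain ⟨n, rfl⟩ := Nat.exists_eq_succ_of_ne_zero (by omega : n ≠ 0)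
      rw [Nat.succ_eq_add_one, downOne, downOne, ← mul_assoc, ← mul_assoc, sg_braid _ (by omega),
        mul_assoc _ (sg (n + 1 + 1)), sg_mul_downOne_far _ _ (by omega)]
      simp only [mul_assoc]

theorem pairBraid_zero_one {s : ℕ} : (pairBraid 0 1 : Braid s) = 1 := by
  simp [pairBraid, down, downOne]

theorem sg_mul_pairBraid_fst {s : ℕ} (a b : ℕ) :
    (sg a * pairBraid a b : Braid s) = pairBraid (a + 1) b := by
  rw [pairBraid, pairBraid, down, mul_assoc]

theorem sg_mul_pairBraid_snd {s : ℕ} (a b : ℕ) (h : a < b) :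
    (sg b * pairBraid a b : Braid s) = pairBraid a (b + 1) := by
  obtain ⟨b, rfl⟩ := Nat.exists_eq_succ_of_ne_zero (by omega : b ≠ 0)
  rw [pairBraid, pairBraid, ← mul_assoc, sg_mul_down_far _ _ h, mul_assoc]
  rfl

theorem sg_mul_pairBraid_far {s : ℕ} (a b m : ℕ) (h : a < b) (hb : b < s + 1)
    (h1 : m + 1 ≠ a) (h2 : m + 1 ≠ b) (h3 : m ≠ a) (h4 : m ≠ b) :
    ∃ j, 2 ≤ j ∧ (sg m * pairBraid a b : Braid s) = pairBraid a b * sg j := by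
  rcases Nat.lt_or_ge b m with h' | h'
  · exact ⟨m, by omega, by rw [pairBraid, ← mul_assoc, sg_mul_down_far _ _ (by omega), mul_assoc,
      sg_mul_downOne_far _ _ (by omega), mul_assoc]⟩
  rcases Nat.lt_or_ge a m with h' | h'
  · exact ⟨m + 1, by omega, by rw [pairBraid, ← mul_assoc, sg_mul_down_far _ _ (by omega),
      mul_assoc, sg_mul_downOne _ _ (by omega) (by omega) (by omega), mul_assoc]⟩
  · exact ⟨m + 1 + 1, by omega, by rw [pairBraid, ← mul_assoc, sg_mul_down _ _ (by omega)
      (by omega), mul_assoc, sg_mul_downOne _ _ (by omega) (by omega) (by omega), mul_assoc]⟩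

theorem pairBraid_succ_self {s : ℕ} (a : ℕ) : (pairBraid (a + 1) (a + 1 + 1) : Braid s) =
    sg a * sg (a + 1) * pairBraid a (a + 1) := by
  rw [← sg_mul_pairBraid_fst, ← sg_mul_pairBraid_snd a (a + 1) (by omega), mul_assoc]

theorem sg_mul_pairBraid_self {s : ℕ} (a : ℕ) (h : a < s) :
    (sg a * pairBraid a (a + 1) : Braid s) = pairBraid a (a + 1) * sg 0 := by
  induction a with
  | zero => simp [pairBraid_zero_one]
  | succ a ih =>
    rw [pairBraid_succ_self, ← mul_assoc, ← mul_assoc, ← sg_braid a h, mul_assoc _ (sg a),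
      ih (by omega)]
    simp only [mul_assoc]

/-! ### A spanning criterion -/

/-- A function on the braid group with values in a module, on which the generators act as they do
on the standard forks up to triangular corrections, takes its values in the span of its values at
the braids `pairBraid a b`. -/
theorem mem_span_pairBraid {k : ℕ} {M : Type*} [AddCommGroup M] [Module Λ M]
    (f : Braid (k + 1) → M)
    (hfar : ∀ x j, 2 ≤ j → f (x * sg j) = f x)
    (s : Λˣ) (hs : ∀ x, f (x * sg 0) = s • f x)
    (hfst : ∀ w m b, m + 1 < b → b < k + 2 → ∃ (α : Λˣ) (β δ : Λ),
      f (w * (sg m * pairBraid (m + 1) b)) =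
        α • f (w * pairBraid m b) + β • f (w * pairBraid (m + 1) b) +
          δ • f (w * pairBraid m (m + 1)))
    (hsnd : ∀ w a m, a < m → m + 1 < k + 2 → ∃ (α : Λˣ) (β δ : Λ),
      f (w * (sg m * pairBraid a (m + 1))) =
        α • f (w * pairBraid a m) + β • f (w * pairBraid a (m + 1)) +
          δ • f (w * pairBraid m (m + 1))) (x : Braid (k + 1)) :
    f x ∈ Submodule.span Λ (Set.range fun p : Pair k => f (pairBraid p.1.1 p.1.2)) := by
  -- `S w` contains the values of `f` at the translates of the basic braids by `w`
  set S : Braid (k + 1) → Submodule Λ M := fun w =>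
    Submodule.span Λ (Set.range fun p : Pair k => f (w * pairBraid p.1.1 p.1.2)) with hS
  have hmem : ∀ w a b, a < b → b < k + 2 → f (w * pairBraid a b) ∈ S w := fun w a b h h' =>
    Submodule.subset_span ⟨⟨(⟨a, by omega⟩, ⟨b, h'⟩), h⟩, rfl⟩
  have hsinv : ∀ x, f (x * (sg 0)⁻¹) = s⁻¹ • f x := fun x => by
    rw [eq_inv_smul_iff, ← hs, inv_mul_cancel_right]
  have hfarinv : ∀ x j, 2 ≤ j → f (x * (sg j)⁻¹) = f x := fun x j hj => by
    rw [← hfar _ j hj, inv_mul_cancel_right]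
  have sgmem : ∀ w m a b, m < k + 1 → a < b → b < k + 2 →
      f (w * (sg m * pairBraid a b)) ∈ S w := by
    intro w m a b hm hab hb
    by_cases h1 : m + 1 = a
    · subst h1
      obtain ⟨α, β, δ, h⟩ := hfst w m b hab hb
      rw [h]
      exact add_mem (add_mem (Submodule.smul_mem _ (α : Λ) (hmem _ _ _ (by omega) (by omega)))
        (Submodule.smul_mem _ _ (hmem _ _ _ (by omega) (by omega))))
        (Submodule.smul_mem _ _ (hmem _ _ _ (by omega) (by omega)))
    by_cases h2 : m = a ∧ m + 1 = b
    · obtain ⟨rfl, rfl⟩ := h2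
      rw [sg_mul_pairBraid_self _ hm, ← mul_assoc, hs]
      exact Submodule.smul_mem _ (s : Λ) (hmem _ _ _ (by omega) (by omega))
    by_cases h3 : m + 1 = b
    · subst h3
      obtain ⟨α, β, δ, h⟩ := hsnd w a m (by omega) hb
      rw [h]
      exact add_mem (add_mem (Submodule.smul_mem _ (α : Λ) (hmem _ _ _ (by omega) (by omega)))
        (Submodule.smul_mem _ _ (hmem _ _ _ (by omega) (by omega))))
        (Submodule.smul_mem _ _ (hmem _ _ _ (by omega) (by omega)))
    by_cases h4 : m = a
    · subst h4
      rw [sg_mul_pairBraid_fst]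
      exact hmem _ _ _ (by omega) hb
    by_cases h5 : m = b
    · subst h5
      rw [sg_mul_pairBraid_snd _ _ hab]
      exact hmem _ _ _ (by omega) (by omega)
    obtain ⟨j, hj, h⟩ := sg_mul_pairBraid_far (s := k + 1) a b m hab hb h1 h3 h4 h5
    rw [h, ← mul_assoc, hfar _ _ hj]
    exact hmem _ _ _ hab hb
  have invmem : ∀ w m a b, m < k + 1 → a < b → b < k + 2 →
      f (w * ((sg m)⁻¹ * pairBraid a b)) ∈ S w := by
    intro w m a b hm hab hb
    have hself : f (w * (sg m)⁻¹ * pairBraid m (m + 1)) ∈ S w := by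
      have h : ((sg m)⁻¹ * pairBraid m (m + 1) : Braid (k + 1)) =
          pairBraid m (m + 1) * (sg 0)⁻¹ := by
        rw [eq_mul_inv_iff_mul_eq, mul_assoc, ← sg_mul_pairBraid_self _ hm, inv_mul_cancel_left]
      rw [mul_assoc, h, ← mul_assoc, hsinv]
      exact Submodule.smul_mem _ (s⁻¹ : Λˣ).val (hmem _ _ _ (by omega) (by omega))
    -- solve the triangular relation at `w * (sg m)⁻¹` for its first term
    have solve : ∀ {x y z v : M} {α : Λˣ} {β δ : Λ}, v = α • x + β • y + δ • z → v ∈ S w →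
        y ∈ S w → z ∈ S w → x ∈ S w := by
      intro x y z v α β δ h hv hy hz
      have : x = (α⁻¹ : Λˣ).val • (v - β • y - δ • z) := by
        rw [h, add_sub_right_comm, add_sub_cancel_right, add_sub_cancel_right]
        exact (inv_smul_smul α x).symm
      rw [this]
      exact Submodule.smul_mem _ _ (sub_mem (sub_mem hv (Submodule.smul_mem _ _ hy))
        (Submodule.smul_mem _ _ hz))
    by_cases h1 : m + 1 = a
    · subst h1
      rw [← sg_mul_pairBraid_fst, inv_mul_cancel_left]
      exact hmem _ _ _ (by omega) hb
    by_cases h2 : m = a ∧ m + 1 = b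
    · obtain ⟨rfl, rfl⟩ := h2
      rw [← mul_assoc]
      exact hself
    by_cases h3 : m + 1 = b
    · subst h3
      rw [← sg_mul_pairBraid_snd _ _ (by omega), inv_mul_cancel_left]
      exact hmem _ _ _ (by omega) (by omega)
    by_cases h4 : m = a
    · subst h4
      obtain ⟨α, β, δ, h⟩ := hfst (w * (sg m)⁻¹) m b (by omega) hb
      rw [← mul_assoc]
      refine solve h ?_ ?_ hself
      · rw [← mul_assoc, inv_mul_cancel_right]
        exact hmem _ _ _ (by omega) hb
      · rw [mul_assoc, ← sg_mul_pairBraid_fst, inv_mul_cancel_left]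
        exact hmem _ _ _ (by omega) hb
    by_cases h5 : m = b
    · subst h5
      obtain ⟨α, β, δ, h⟩ := hsnd (w * (sg m)⁻¹) a m (by omega) (by omega)
      rw [← mul_assoc]
      refine solve h ?_ ?_ hself
      · rw [← mul_assoc, inv_mul_cancel_right]
        exact hmem _ _ _ (by omega) (by omega)
      · rw [mul_assoc, ← sg_mul_pairBraid_snd _ _ hab, inv_mul_cancel_left]
        exact hmem _ _ _ (by omega) (by omega)
    obtain ⟨j, hj, h⟩ := sg_mul_pairBraid_far (s := k + 1) a b m hab hb h1 h3 h4 h5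
    have h : ((sg m)⁻¹ * pairBraid a b : Braid (k + 1)) = pairBraid a b * (sg j)⁻¹ := by
      rw [eq_mul_inv_iff_mul_eq, mul_assoc, ← h, inv_mul_cancel_left]
    rw [h, ← mul_assoc, hfarinv _ _ hj]
    exact hmem _ _ _ hab hb
  have key : ∀ y w : Braid (k + 1), S w ≤ S 1 → S (w * y) ≤ S 1 := by
    intro y
    induction y using braid_induction with
    | one => intro w h; rwa [mul_one]
    | mul i y ih =>
      intro w h
      rw [← mul_assoc]
      refine ih _ ?_
      refine le_trans (Submodule.span_le.2 ?_) h
      rintro _ ⟨p, rfl⟩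
      have := sgmem w i p.1.1 p.1.2 i.2 p.2 p.1.2.2
      rwa [sg_eq i.2, ← mul_assoc] at this
    | inv_mul i y ih =>
      intro w h
      rw [← mul_assoc]
      refine ih _ ?_
      refine le_trans (Submodule.span_le.2 ?_) h
      rintro _ ⟨p, rfl⟩
      have := invmem w i p.1.1 p.1.2 i.2 p.2 p.1.2.2
      rwa [sg_eq i.2, ← mul_assoc] at this
  have hx := key x 1 le_rfl (hmem (1 * x) 0 1 (by omega) (by omega))
  simpa only [hS, one_mul, pairBraid_zero_one, mul_one] using hx

/-! ### Calculus in the skein algebra -/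

/-- Additive inverses in the quotient come from the scalars.  Only the additive group is declared,
so that products and scalar multiples keep referring to the semiring structure of the quotient. -/
instance skeinAddCommGroup (k : ℕ) : AddCommGroup (RingQuot (SkeinRel k)) :=
  Module.addCommMonoidToAddCommGroup Λ

/-- The module structure, declared so that scalar multiples are read as part of it. -/
instance skeinModule (k : ℕ) : Module Λ (RingQuot (SkeinRel k)) := Algebra.toModule

theorem skein_smul_mul {k : ℕ} (r : Λ) (x y : RingQuot (SkeinRel k)) : r • x * y = r • (x * y) :=
  Algebra.smul_mul_assoc r x y

/-- The class in the skein algebra of the geometric bifork given by a picture. -/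
def cls {k : ℕ} (u : Braid (k + 1)) (h : Fin (k + 1)) (m : Braid k) (l : Braid (k + 1)) :
    RingQuot (SkeinRel k) :=
  skeinClass (Quot.mk _ ⟨u, h, m, l⟩)

theorem cls_eq_mk {k : ℕ} (u : Braid (k + 1)) (h : Fin (k + 1)) (m : Braid k)
    (l : Braid (k + 1)) : cls u h m l = RingQuot.mkAlgHom Λ (SkeinRel k) (gen u h m l) := rfl

theorem cls_cup {k : ℕ} (u : Braid (k + 1)) (h : Fin (k + 1)) (i : Fin k) (m : Braid k)
    (l : Braid (k + 1)) :
    cls u h (σ i * m) l = cls (u * double h i) (trace h (σ i)) m l :=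
  congrArg skeinClass (Quot.sound (Isotopy.cup u h i m l))

theorem cls_cap {k : ℕ} (u : Braid (k + 1)) (h : Fin (k + 1)) (m : Braid k) (i : Fin k)
    (l : Braid (k + 1)) :
    cls u h (m * σ i) l = cls u h m (double (trace h m) i * l) :=
  congrArg skeinClass (Quot.sound (Isotopy.cap u h m i l))

theorem cls_twist {k : ℕ} (u : Braid (k + 1)) (h : Fin (k + 1)) (m : Braid k)
    (l : Braid (k + 1)) : cls (u * σ h) h m l = cls u h m (σ (trace h m) * l) :=
  congrArg skeinClass (Quot.sound (Isotopy.twist u h m l))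

theorem mk_eq {k : ℕ} {x y : FreeAlgebra Λ (GeomBifork k)} (h : SkeinRel k x y) :
    RingQuot.mkAlgHom Λ (SkeinRel k) x = RingQuot.mkAlgHom Λ (SkeinRel k) y :=
  RingQuot.mkAlgHom_rel Λ h

theorem cls_concat {k : ℕ} (u h m l b u' h' m' l') :
    (cls u h m (l * b) * cls u' h' m' l' : RingQuot (SkeinRel k)) =
      cls u h m l * cls (b * u') h' m' l' := by
  simpa only [map_mul, ← cls_eq_mk] using mk_eq (SkeinRel.concat u h m l b u' h' m' l')

theorem cls_resolve_above {k : ℕ} (b i u h m l) :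
    (cls (b * σ i * u) h m l - q • cls (b * (σ i)⁻¹ * u) h m l : RingQuot (SkeinRel k)) =
      (1 - q) • cls (b * u) h m l - cls b i 1 1 * cls u h m l := by
  simpa only [map_mul, map_sub, map_smul, ← cls_eq_mk] using
    mk_eq (SkeinRel.resolve_above b i u h m l)

theorem cls_resolve_below {k : ℕ} (u h m l i c) :
    (cls u h m (l * σ i * c) - q • cls u h m (l * (σ i)⁻¹ * c) : RingQuot (SkeinRel k)) =
      (1 - q) • cls u h m (l * c) - cls u h m l * cls 1 i 1 c := by
  simpa only [map_mul, map_sub, map_smul, ← cls_eq_mk] using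
    mk_eq (SkeinRel.resolve_below u h m l i c)

theorem cls_half_twist {k : ℕ} (b h c) :
    (cls b h 1 (σ h * c) : RingQuot (SkeinRel k)) = (-t * q ^ 2) • cls b h 1 c := by
  simpa only [map_smul, ← cls_eq_mk] using mk_eq (SkeinRel.half_twist b h c)

theorem cls_crossing_beside {k : ℕ} (b h c) (i : Fin k) (h1 : i.val ≠ h.val)
    (h2 : i.val + 1 ≠ h.val) : (cls b h (σ i) c : RingQuot (SkeinRel k)) = cls b h 1 c := by
  simpa only [← cls_eq_mk] using mk_eq (SkeinRel.crossing_beside b h c i h1 h2)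

theorem cls_handle_loop {k : ℕ} (b h c) (i : Fin k) (h1 : i.val = h.val ∨ i.val + 1 = h.val) :
    (cls b h (σ i * σ i) c : RingQuot (SkeinRel k)) = q ^ 2 • cls b h 1 c := by
  simpa only [map_smul, ← cls_eq_mk] using mk_eq (SkeinRel.handle_loop b h c i h1)

theorem cls_exchange_right {k : ℕ} (b c) (i : Fin k) :
    (cls b i.castSucc 1 1 * cls 1 i.succ 1 c : RingQuot (SkeinRel k)) =
      (q * (1 - q)) • cls b i.castSucc (σ i)⁻¹ c := by
  simpa only [map_mul, map_smul, ← cls_eq_mk] using mk_eq (SkeinRel.exchange_right b c i)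

theorem cls_exchange_left {k : ℕ} (b c) (i : Fin k) :
    (cls b i.succ 1 1 * cls 1 i.castSucc 1 c : RingQuot (SkeinRel k)) =
      (q * (1 - q)) • cls b i.succ (σ i)⁻¹ c := by
  simpa only [map_mul, map_smul, ← cls_eq_mk] using mk_eq (SkeinRel.exchange_left b c i)

/-- A doubled crossing is transported along the handle of a simple bifork. -/
theorem cls_slide {k : ℕ} (u : Braid (k + 1)) (h : Fin (k + 1)) (i : Fin k) (l : Braid (k + 1)) :
    cls u h 1 (double h i * l) = cls (u * double h i) (trace h (σ i)) 1 l := by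
  have h1 := cls_cap u h 1 i l
  have h2 := cls_cup u h i 1 l
  rw [one_mul, trace_one] at h1
  rw [mul_one] at h2
  rw [← h1, h2]

/-- Every geometric bifork is isotopic to one whose handle crosses nothing. -/
theorem exists_cls_eq {k : ℕ} (m : Braid k) : ∀ (u : Braid (k + 1)) (h : Fin (k + 1))
    (l : Braid (k + 1)), ∃ u' h', cls u h m l = cls u' h' 1 l := by
  induction m using braid_induction with
  | one => exact fun u h l => ⟨u, h, rfl⟩
  | mul i m ih => exact fun u h l => by rw [cls_cup]; exact ih _ _ _
  | inv_mul i m ih =>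
    intro u h l
    have := cls_cup (u * (double (trace h (σ i)⁻¹) i)⁻¹) (trace h (σ i)⁻¹) i ((σ i)⁻¹ * m) l
    rw [mul_inv_cancel_left, inv_mul_cancel_right, ← trace_mul, inv_mul_cancel, trace_one] at this
    rw [← this]
    exact ih _ _ _

/-- The simple bifork in position `h` with the braids `u` and `l` attached at its top and its
bottom; `h` is a natural number, read modulo `k + 1`. -/
def simple {k : ℕ} (h : ℕ) (u l : Braid (k + 1)) : RingQuot (SkeinRel k) :=
  cls u (Fin.ofNat (k + 1) h) 1 l

theorem simple_eq {k h : ℕ} (hh : h < k + 1) (u l : Braid (k + 1)) :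
    simple h u l = cls u ⟨h, hh⟩ 1 l := by
  rw [simple]; congr 1; exact Fin.ext (Nat.mod_eq_of_lt hh)

theorem simple_concat {k : ℕ} (h h' : ℕ) (u l b u' l' : Braid (k + 1)) :
    simple h u (l * b) * simple h' u' l' = simple h u l * simple h' (b * u') l' :=
  cls_concat _ _ _ _ _ _ _ _ _

theorem simple_resolve_above {k i : ℕ} (hi : i < k + 1) (b u l : Braid (k + 1)) (h : ℕ) :
    simple h (b * sg i * u) l - q • simple h (b * (sg i)⁻¹ * u) l =
      (1 - q) • simple h (b * u) l - simple i b 1 * simple h u l := by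
  rw [sg_eq hi, simple_eq hi]; exact cls_resolve_above _ _ _ _ _ _

theorem simple_resolve_below {k i : ℕ} (hi : i < k + 1) (u l c : Braid (k + 1)) (h : ℕ) :
    simple h u (l * sg i * c) - q • simple h u (l * (sg i)⁻¹ * c) =
      (1 - q) • simple h u (l * c) - simple h u l * simple i 1 c := by
  rw [sg_eq hi, simple_eq hi]; exact cls_resolve_below _ _ _ _ _ _

theorem simple_twist {k h : ℕ} (hh : h < k + 1) (u l : Braid (k + 1)) :
    simple h u (sg h * l) = (-t * q ^ 2) • simple h u l := by
  rw [sg_eq hh, simple_eq hh, simple_eq hh]; exact cls_half_twist _ _ _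

theorem simple_twist_above {k h : ℕ} (hh : h < k + 1) (u l : Braid (k + 1)) :
    simple h (u * sg h) l = (-t * q ^ 2) • simple h u l := by
  rw [← simple_twist hh, sg_eq hh, simple_eq hh, simple_eq hh, cls_twist, trace_one]

theorem simple_slide_right {k h : ℕ} (hh : h + 1 < k + 1) (u l : Braid (k + 1)) :
    simple h u (sg (h + 1) * sg h * l) = simple (h + 1) (u * (sg (h + 1) * sg h)) l := by
  have := cls_slide u (⟨h, by omega⟩ : Fin k).castSucc ⟨h, by omega⟩ l
  rw [double_castSucc, trace_σ_castSucc] at this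
  rw [sg_eq hh, sg_eq (by omega : h < k + 1), simple_eq hh, simple_eq (by omega : h < k + 1)]
  exact this

theorem simple_slide_left {k h : ℕ} (hh : h + 1 < k + 1) (u l : Braid (k + 1)) :
    simple (h + 1) u (sg h * sg (h + 1) * l) = simple h (u * (sg h * sg (h + 1))) l := by
  have := cls_slide u (⟨h, by omega⟩ : Fin k).succ ⟨h, by omega⟩ l
  rw [double_succ, trace_σ_succ] at this
  rw [sg_eq hh, sg_eq (by omega : h < k + 1), simple_eq hh, simple_eq (by omega : h < k + 1)]
  exact this

/-- A simple bifork absorbs the crossings that are away from its tines. -/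
theorem simple_far {k h : ℕ} (hh : h < k + 1) (j : ℕ) (hj : h + 1 < j ∨ j + 1 < h)
    (u l : Braid (k + 1)) : simple h u (sg j * l) = simple h u l := by
  by_cases hjk : j < k + 1
  swap
  · rw [sg, dif_neg hjk, one_mul]
  rw [sg_eq hjk, simple_eq hh, simple_eq hh]
  obtain ⟨i, h1, h2, hi⟩ : ∃ i : Fin k, i.val ≠ h ∧ i.val + 1 ≠ h ∧
      double (⟨h, hh⟩ : Fin (k + 1)) i = σ ⟨j, hjk⟩ := by
    rcases hj with hj | hj
    · refine ⟨⟨j - 1, by omega⟩, by simp; omega, by simp; omega, ?_⟩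
      rw [double, if_neg (by simp; omega), if_neg (by simp; omega), if_neg (by simp; omega)]
      congr 1; ext; simp; omega
    · refine ⟨⟨j, by omega⟩, by simp; omega, by simp; omega, ?_⟩
      rw [double, if_neg (by simp; omega), if_neg (by simp; omega), if_pos (by simp; omega)]
      rfl
  have := cls_cap u ⟨h, hh⟩ 1 i l
  rw [one_mul, trace_one, cls_crossing_beside _ _ _ _ h1 h2, hi] at this
  exact this.symm

theorem simple_far_above {k h : ℕ} (hh : h < k + 1) (j : ℕ) (hj : h + 1 < j ∨ j + 1 < h)
    (u l : Braid (k + 1)) : simple h (u * sg j) l = simple h u l := by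
  by_cases hjk : j < k + 1
  swap
  · rw [sg, dif_neg hjk, mul_one]
  rw [sg_eq hjk, simple_eq hh, simple_eq hh]
  obtain ⟨i, h1, h2, hi⟩ : ∃ i : Fin k, i.val ≠ h ∧ i.val + 1 ≠ h ∧
      double (⟨h, hh⟩ : Fin (k + 1)) i = σ ⟨j, hjk⟩ := by
    rcases hj with hj | hj
    · refine ⟨⟨j - 1, by omega⟩, by simp; omega, by simp; omega, ?_⟩
      rw [double, if_neg (by simp; omega), if_neg (by simp; omega), if_neg (by simp; omega)]
      congr 1; ext; simp; omega
    · refine ⟨⟨j, by omega⟩, by simp; omega, by simp; omega, ?_⟩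
      rw [double, if_neg (by simp; omega), if_neg (by simp; omega), if_pos (by simp; omega)]
      rfl
  have := cls_cup u ⟨h, hh⟩ i 1 l
  rw [mul_one, cls_crossing_beside _ _ _ _ h1 h2, hi, trace_σ_far _ _ h1 h2] at this
  exact this.symm

/-- A string going once around the doubled handle. -/
theorem simple_loop_right {k h : ℕ} (hh : h + 1 < k + 1) (u l : Braid (k + 1)) :
    simple h u (sg (h + 1) * sg h * (sg h * sg (h + 1) * l)) = q ^ 2 • simple h u l := by
  have h1 := cls_handle_loop u (⟨h, by omega⟩ : Fin k).castSucc l ⟨h, by omega⟩ (Or.inl rfl)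
  have h2 := cls_cap u (⟨h, by omega⟩ : Fin k).castSucc 1 ⟨h, by omega⟩
    (double (⟨h, by omega⟩ : Fin k).succ ⟨h, by omega⟩ * l)
  rw [cls_cap, trace_σ_castSucc] at h1
  rw [one_mul, trace_one, double_castSucc, h1, double_succ] at h2
  rw [sg_eq hh, sg_eq (by omega : h < k + 1), simple_eq (by omega : h < k + 1),
    simple_eq (by omega : h < k + 1)]
  exact h2.symm

theorem simple_loop_left {k h : ℕ} (hh : h + 1 < k + 1) (u l : Braid (k + 1)) :
    simple (h + 1) u (sg h * sg (h + 1) * (sg (h + 1) * sg h * l)) =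
      q ^ 2 • simple (h + 1) u l := by
  have h1 := cls_handle_loop u (⟨h, by omega⟩ : Fin k).succ l ⟨h, by omega⟩ (Or.inr rfl)
  have h2 := cls_cap u (⟨h, by omega⟩ : Fin k).succ 1 ⟨h, by omega⟩
    (double (⟨h, by omega⟩ : Fin k).castSucc ⟨h, by omega⟩ * l)
  rw [cls_cap, trace_σ_succ] at h1
  rw [one_mul, trace_one, double_succ, h1, double_castSucc] at h2
  rw [sg_eq hh, sg_eq (by omega : h < k + 1), simple_eq hh, simple_eq hh]
  exact h2.symm

theorem simple_exchange_right {k h : ℕ} (hh : h + 1 < k + 1) (b c : Braid (k + 1)) :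
    simple h b 1 * simple (h + 1) 1 (sg h * sg (h + 1) * c) = (q * (1 - q)) • simple h b c := by
  have h1 := cls_exchange_right b (double (⟨h, by omega⟩ : Fin k).succ ⟨h, by omega⟩ * c)
    (⟨h, by omega⟩ : Fin k)
  have h2 := cls_cap b (⟨h, by omega⟩ : Fin k).castSucc (σ ⟨h, by omega⟩)⁻¹ ⟨h, by omega⟩ c
  rw [← trace_σ_succ, ← trace_mul, mul_inv_cancel, trace_one, inv_mul_cancel, trace_σ_succ] at h2
  rw [← h2, double_succ] at h1
  rw [sg_eq hh, sg_eq (by omega : h < k + 1), simple_eq hh, simple_eq (by omega : h < k + 1),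
    simple_eq (by omega : h < k + 1)]
  exact h1

theorem simple_exchange_left {k h : ℕ} (hh : h + 1 < k + 1) (b c : Braid (k + 1)) :
    simple (h + 1) b 1 * simple h 1 (sg (h + 1) * sg h * c) =
      (q * (1 - q)) • simple (h + 1) b c := by
  have h1 := cls_exchange_left b (double (⟨h, by omega⟩ : Fin k).castSucc ⟨h, by omega⟩ * c)
    (⟨h, by omega⟩ : Fin k)
  have h2 := cls_cap b (⟨h, by omega⟩ : Fin k).succ (σ ⟨h, by omega⟩)⁻¹ ⟨h, by omega⟩ c
  rw [← trace_σ_castSucc, ← trace_mul, mul_inv_cancel, trace_one, inv_mul_cancel,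
    trace_σ_castSucc] at h2
  rw [← h2, double_castSucc] at h1
  rw [sg_eq hh, sg_eq (by omega : h < k + 1), simple_eq hh, simple_eq (by omega : h < k + 1),
    simple_eq hh]
  exact h1

/-- The simple bifork in position `h` is conjugate to the one in position `0`. -/
theorem simple_conj {k h : ℕ} (hh : h < k + 1) : ∀ u l : Braid (k + 1),
    simple h u (pairBraid h (h + 1) * l) = simple 0 (u * pairBraid h (h + 1)) l := by
  induction h with
  | zero => intro u l; rw [pairBraid_zero_one, one_mul, mul_one]
  | succ h ih =>
    intro u l
    rw [pairBraid_succ_self, mul_assoc, simple_slide_left hh, ih (by omega)]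
    simp only [mul_assoc]

theorem simple_eq_zero_pos {k h : ℕ} (hh : h < k + 1) (u l : Braid (k + 1)) :
    simple h u l = simple 0 (u * pairBraid h (h + 1)) ((pairBraid h (h + 1))⁻¹ * l) := by
  rw [← simple_conj hh, mul_inv_cancel_left]

theorem exists_cls_eq_simple {k : ℕ} (u : Braid (k + 1)) (h : Fin (k + 1)) (m : Braid k)
    (l : Braid (k + 1)) : ∃ β γ, cls u h m l = simple 0 β γ := by
  obtain ⟨u', h', hu⟩ := exists_cls_eq m u h l
  exact ⟨_, _, by rw [hu, ← simple_eq h'.2, simple_eq_zero_pos h'.2]⟩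

theorem simple_zero_eq_attach {k : ℕ} (β γ : Braid (k + 1)) :
    simple 0 β γ = skeinClass (attach β γ) := rfl

/-! ### Products of simple biforks with standard ones -/

theorem simple_mul_far {k i j : ℕ} (hi : i < k + 1) (hj : i + 1 < j ∨ j + 1 < i) (h : ℕ)
    (b u l : Braid (k + 1)) :
    simple i b 1 * simple h (sg j * u) l = simple i b 1 * simple h u l := by
  rw [← simple_concat, one_mul, ← mul_one (sg j), simple_far hi j hj]

theorem simple_mul_twist {k i : ℕ} (hi : i < k + 1) (h : ℕ) (b u l : Braid (k + 1)) :
    simple i b 1 * simple h (sg i * u) l = (-t * q ^ 2) • (simple i b 1 * simple h u l) := by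
  rw [← simple_concat, one_mul, ← mul_one (sg i), simple_twist hi, skein_smul_mul]

theorem far_mul_simple {k i j : ℕ} (hi : i < k + 1) (hj : i + 1 < j ∨ j + 1 < i) (h : ℕ)
    (u l c : Braid (k + 1)) :
    simple h u (l * sg j) * simple i 1 c = simple h u l * simple i 1 c := by
  rw [simple_concat, mul_one, ← one_mul (sg j), simple_far_above hi j hj]

theorem qinv_sq_smul {k : ℕ} {x y : RingQuot (SkeinRel k)} (h : x = q ^ 2 • y) :
    y = qinv ^ 2 • x := by
  rw [h, smul_smul, ← mul_pow, mul_comm, q_mul_qinv, one_pow, one_smul]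

/-- The product of a simple bifork in position `m` with the standard upper half `(m + 1, b)` is a
multiple of the one with upper half `(m, m + 1)`. -/
theorem simple_mul_fst {k m b : ℕ} (hm : m + 1 < b) (hb : b < k + 2) (w γ : Braid (k + 1)) :
    simple m w 1 * simple 0 (pairBraid (m + 1) b) γ =
      (q * (1 - q)) • simple 0 (w * pairBraid m (m + 1)) γ := by
  have h1 : ∀ n, m + 1 + 1 + n < k + 2 → simple m w 1 * simple 0 (pairBraid m (m + 1 + 1 + n)) γ =
      simple m w 1 * simple 0 (pairBraid m (m + 1 + 1)) γ := by
    intro n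
    induction n with
    | zero => intro _; rfl
    | succ n ih =>
      intro hn
      rw [← ih (by omega), ← add_assoc, ← sg_mul_pairBraid_snd _ _ (by omega),
        simple_mul_far (by omega) (by omega)]
  obtain ⟨n, rfl⟩ := Nat.exists_eq_add_of_lt hm
  rw [add_right_comm] at hb ⊢
  rw [← sg_mul_pairBraid_fst, simple_mul_twist (by omega), h1 n hb,
    ← sg_mul_pairBraid_snd _ _ (by omega), ← simple_conj (by omega)]
  -- the handle of the lower bifork is moved one position to the right
  have h2 := simple_slide_left (k := k) (h := m) (by omega) (sg m)⁻¹ (pairBraid m (m + 1) * γ)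
  rw [inv_mul_cancel_left] at h2
  rw [← h2, ← simple_mul_twist (by omega), mul_inv_cancel, simple_exchange_right (by omega),
    simple_conj (by omega)]

/-- The product of a simple bifork in position `m` with the standard upper half `(a, m + 1)` is a
multiple of the one with upper half `(m, m + 1)`. -/
theorem simple_mul_snd {k m a : ℕ} (ha : a < m) (hm : m + 1 < k + 2) (w γ : Braid (k + 1)) :
    simple m w 1 * simple 0 (pairBraid a (m + 1)) γ =
      ((-t * q ^ 2) * (q * (1 - q)) * qinv ^ 2) • simple 0 (w * pairBraid m (m + 1)) γ := by
  obtain ⟨n, rfl⟩ := Nat.exists_eq_add_of_lt ha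
  have h1 : ∀ n a, a + n + 1 < k + 1 →
      simple (a + n + 1) w 1 * simple 0 (pairBraid a (a + n + 1)) γ =
      simple (a + n + 1) w 1 * simple 0 (pairBraid (a + n) (a + n + 1)) γ := by
    intro n
    induction n with
    | zero => intro a _; rfl
    | succ n ih =>
      intro a hn
      have h := ih (a + 1) (by omega)
      rw [add_right_comm a 1 n, ← add_assoc] at *
      rw [← h, ← sg_mul_pairBraid_fst, simple_mul_far (by omega) (by omega)]
  rw [← sg_mul_pairBraid_snd _ _ (by omega), simple_mul_twist (by omega), h1 n a (by omega)]
  generalize a + n = m at hm ⊢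
  have h2 := simple_conj (k := k) (h := m) (by omega) 1 γ
  rw [one_mul] at h2
  rw [← h2]
  have h3 := simple_exchange_left (k := k) (h := m) (by omega) w
    ((sg (m + 1) * sg m)⁻¹ * (pairBraid m (m + 1) * γ))
  have h4 := simple_loop_left (k := k) (h := m) (by omega) w
    ((sg (m + 1) * sg m)⁻¹ * (pairBraid m (m + 1) * γ))
  rw [mul_inv_cancel_left] at h3 h4
  rw [h3, qinv_sq_smul h4, ← mul_assoc _ _ γ, ← pairBraid_succ_self, simple_conj (by omega),
    smul_smul, smul_smul, mul_assoc]

theorem simple_conj_inv {k h : ℕ} (hh : h < k + 1) (u l : Braid (k + 1)) :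
    simple 0 u ((pairBraid h (h + 1))⁻¹ * l) = simple h (u * (pairBraid h (h + 1))⁻¹) l := by
  have := simple_conj hh (u * (pairBraid h (h + 1))⁻¹) ((pairBraid h (h + 1))⁻¹ * l)
  rw [mul_inv_cancel_left, inv_mul_cancel_right] at this
  exact this.symm

theorem simple_conj_inv_one {k h : ℕ} (hh : h < k + 1) (u : Braid (k + 1)) :
    simple 0 u (pairBraid h (h + 1))⁻¹ = simple h (u * (pairBraid h (h + 1))⁻¹) 1 := by
  rw [← simple_conj_inv hh, mul_one]

/-- The product of the standard lower half `(m, b)` with a simple bifork in position `m` is a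
multiple of the one with lower half `(m, m + 1)`. -/
theorem fst_mul_simple {k m b : ℕ} (hm : m + 1 < b) (hb : b < k + 2) (β c : Braid (k + 1)) :
    simple 0 β (pairBraid m b)⁻¹ * simple m 1 c =
      ((-t * q ^ 2) * (q * (1 - q)) * qinv ^ 2) • simple 0 β ((pairBraid m (m + 1))⁻¹ * c) := by
  have h1 : ∀ n, m + 1 + 1 + n < k + 2 → simple 0 β (pairBraid m (m + 1 + 1 + n))⁻¹ * simple m 1 c =
      simple 0 β (pairBraid m (m + 1 + 1))⁻¹ * simple m 1 c := by
    intro n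
    induction n with
    | zero => intro _; rfl
    | succ n ih =>
      intro hn
      rw [← ih (by omega), ← add_assoc, ← sg_mul_pairBraid_snd _ _ (by omega),
        ← far_mul_simple (j := m + 1 + 1 + n) (by omega) (by omega), _root_.mul_inv_rev,
        inv_mul_cancel_right]
  obtain ⟨n, rfl⟩ := Nat.exists_eq_add_of_lt hm
  rw [add_right_comm] at hb ⊢
  rw [h1 n hb, ← sg_mul_pairBraid_snd _ _ (by omega), _root_.mul_inv_rev, simple_concat,
    simple_conj_inv_one (by omega), simple_conj_inv (by omega), mul_one]
  generalize β * (pairBraid m (m + 1))⁻¹ = v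
  -- the handle of the lower bifork is moved one position to the right
  have h2 := simple_slide_right (k := k) (h := m) (by omega) (sg (m + 1))⁻¹
    ((sg (m + 1) * sg m)⁻¹ * c)
  rw [mul_inv_cancel_left, inv_mul_cancel_left] at h2
  have h3 := simple_exchange_right (k := k) (h := m) (by omega) v
    ((sg m * sg (m + 1))⁻¹ * ((sg (m + 1) * sg m)⁻¹ * c))
  have h4 := simple_loop_right (k := k) (h := m) (by omega) v
    ((sg m * sg (m + 1))⁻¹ * ((sg (m + 1) * sg m)⁻¹ * c))
  rw [mul_inv_cancel_left] at h3
  rw [mul_inv_cancel_left, mul_inv_cancel_left] at h4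
  have h5 := simple_mul_twist (k := k) (i := m) (by omega) (m + 1) v 1 ((sg (m + 1) * sg m)⁻¹ * c)
  rw [mul_one] at h5
  rw [h2, h5, h3, qinv_sq_smul h4, smul_smul, smul_smul, mul_assoc]

/-- The product of the standard lower half `(a, m)` with a simple bifork in position `m` is a
multiple of the one with lower half `(m, m + 1)`. -/
theorem snd_mul_simple {k m a : ℕ} (ha : a < m) (hm : m + 1 < k + 2) (β c : Braid (k + 1)) :
    simple 0 β (pairBraid a m)⁻¹ * simple m 1 c =
      (q * (1 - q)) • simple 0 β ((pairBraid m (m + 1))⁻¹ * c) := by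
  obtain ⟨n, rfl⟩ := Nat.exists_eq_add_of_lt ha
  have h1 : ∀ n a, a + n + 1 < k + 1 →
      simple 0 β (pairBraid a (a + n + 1))⁻¹ * simple (a + n + 1) 1 c =
      simple 0 β (pairBraid (a + n) (a + n + 1))⁻¹ * simple (a + n + 1) 1 c := by
    intro n
    induction n with
    | zero => intro a _; rfl
    | succ n ih =>
      intro a hn
      have h := ih (a + 1) (by omega)
      rw [add_right_comm a 1 n, ← add_assoc] at *
      rw [← h, ← sg_mul_pairBraid_fst, ← far_mul_simple (j := a) (by omega) (by omega) 0 β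
        (sg a * _)⁻¹, _root_.mul_inv_rev, inv_mul_cancel_right]
  rw [h1 n a (by omega)]
  generalize a + n = m at hm ⊢
  have h3 := simple_exchange_right (k := k) (h := m) (by omega) (β * (pairBraid m (m + 1))⁻¹)
    ((sg m * sg (m + 1))⁻¹ * c)
  rw [mul_inv_cancel_left] at h3
  rw [simple_conj_inv_one (by omega), h3, ← simple_conj_inv (by omega), pairBraid_succ_self,
    _root_.mul_inv_rev _ (pairBraid m (m + 1)), mul_assoc]

/-! ### The standard geometric biforks span -/

/-- The scalar `-t q²` of a half twist. -/
def twistUnit : Λˣ where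
  val := -t * q ^ 2
  inv := -tinv * qinv ^ 2
  val_inv := by have := t_mul_tinv; have := q_mul_qinv; grind
  inv_val := by have := t_mul_tinv; have := q_mul_qinv; grind

theorem twistUnit_smul {M : Type*} [AddCommMonoid M] [Module Λ M] (x : M) :
    twistUnit • x = (-t * q ^ 2) • x := rfl

theorem qUnit_smul {M : Type*} [AddCommMonoid M] [Module Λ M] (x : M) : qUnit • x = q • x := rfl

theorem simple_mem_span_above {k : ℕ} (β γ : Braid (k + 1)) :
    simple 0 β γ ∈ Submodule.span Λ
      (Set.range fun p : Pair k => simple 0 (pairBraid p.1.1 p.1.2) γ) := by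
  refine mem_span_pairBraid (fun x => simple 0 x γ) (fun x j hj => ?_) twistUnit (fun x => ?_)
    (fun w m b hm hb => ⟨qUnit, 1 - q, -(q * (1 - q)), ?_⟩)
    (fun w a m ha hm => ⟨qUnit, 1 - q, -((-t * q ^ 2) * (q * (1 - q)) * qinv ^ 2), ?_⟩) β
  · exact simple_far_above (by omega) j (by omega) _ _
  · exact simple_twist_above (by omega) _ _
  · have h := simple_resolve_above (k := k) (i := m) (by omega) w (pairBraid (m + 1) b) γ 0
    rw [simple_mul_fst hm hb, mul_assoc, mul_assoc, ← sg_mul_pairBraid_fst m b,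
      inv_mul_cancel_left, sg_mul_pairBraid_fst, sub_eq_iff_eq_add] at h
    simp only [qUnit_smul]
    rw [h, neg_smul]; abel
  · have h := simple_resolve_above (k := k) (i := m) (by omega) w (pairBraid a (m + 1)) γ 0
    rw [simple_mul_snd ha hm, mul_assoc, mul_assoc, ← sg_mul_pairBraid_snd a m ha,
      inv_mul_cancel_left, sg_mul_pairBraid_snd a m ha, sub_eq_iff_eq_add] at h
    simp only [qUnit_smul]
    rw [h, neg_smul]; abel

theorem simple_inv_twist {k : ℕ} (u l : Braid (k + 1)) :
    simple 0 u ((sg 0)⁻¹ * l) = twistUnit⁻¹ • simple 0 u l := by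
  rw [eq_inv_smul_iff, twistUnit_smul, ← simple_twist (by omega), mul_inv_cancel_left]

/-- Solving the skein relation at a crossing below the maximum for the inverse crossing. -/
theorem simple_below_triangular {k m : ℕ} (hm : m < k + 1) (β A w : Braid (k + 1)) (δ : Λ)
    (h : ∀ c, simple 0 β A⁻¹ * simple m 1 c = δ • simple 0 β ((pairBraid m (m + 1))⁻¹ * c)) :
    simple 0 β (w * (sg m * (sg m * A)))⁻¹ = qUnit⁻¹ • simple 0 β (w * A)⁻¹ +
      (-(qinv * (1 - q))) • simple 0 β (w * (sg m * A))⁻¹ +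
      (qinv * δ * (twistUnit⁻¹ : Λˣ)) • simple 0 β (w * pairBraid m (m + 1))⁻¹ := by
  have h1 := simple_resolve_below (k := k) hm β A⁻¹ ((sg m)⁻¹ * w⁻¹) 0
  have h2 : ((pairBraid m (m + 1))⁻¹ * ((sg m)⁻¹ * w⁻¹) : Braid (k + 1)) =
      (sg 0)⁻¹ * (w * pairBraid m (m + 1))⁻¹ := by
    rw [← mul_assoc, ← _root_.mul_inv_rev, sg_mul_pairBraid_self m hm, _root_.mul_inv_rev,
      _root_.mul_inv_rev, mul_assoc]
  rw [h, h2, simple_inv_twist] at h1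
  have e1 : A⁻¹ * sg m * ((sg m)⁻¹ * w⁻¹) = (w * A)⁻¹ := by group
  have e2 : A⁻¹ * (sg m)⁻¹ * ((sg m)⁻¹ * w⁻¹) = (w * (sg m * (sg m * A)))⁻¹ := by group
  have e3 : A⁻¹ * ((sg m)⁻¹ * w⁻¹) = (w * (sg m * A))⁻¹ := by group
  rw [e1, e2, e3] at h1
  generalize simple 0 β (w * A)⁻¹ = x at *
  generalize simple 0 β (w * (sg m * (sg m * A)))⁻¹ = y at *
  generalize simple 0 β (w * (sg m * A))⁻¹ = z at *
  generalize simple 0 β (w * pairBraid m (m + 1))⁻¹ = v at *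
  have h3 : qUnit • y = x - (1 - q) • z + δ • twistUnit⁻¹ • v := by
    rw [qUnit_smul]
    rw [sub_eq_iff_eq_add] at h1
    rw [h1]; abel
  rw [← eq_inv_smul_iff] at h3
  rw [h3, smul_add, smul_sub, neg_smul, mul_smul, mul_smul, mul_smul, ← sub_eq_add_neg]
  rfl

theorem simple_mem_span_below {k : ℕ} (β γ : Braid (k + 1)) :
    simple 0 β γ ∈ Submodule.span Λ
      (Set.range fun p : Pair k => simple 0 β (pairBraid p.1.1 p.1.2)⁻¹) := by
  have hs : ∀ x : Braid (k + 1), simple 0 β (x * sg 0)⁻¹ = twistUnit⁻¹ • simple 0 β x⁻¹ := by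
    intro x
    rw [_root_.mul_inv_rev, simple_inv_twist]
  have := mem_span_pairBraid (fun x => simple 0 β x⁻¹) (fun x j hj => ?_) twistUnit⁻¹ hs
    (fun w m b hm hb => ?_) (fun w a m ha hm => ?_) γ⁻¹
  · simpa only [inv_inv] using this
  · rw [← simple_far (by omega : 0 < k + 1) j (by omega), _root_.mul_inv_rev, mul_inv_cancel_left]
  · have := simple_below_triangular (by omega) β (pairBraid m b) w _ (fst_mul_simple hm hb β)
    rw [sg_mul_pairBraid_fst] at this
    exact ⟨_, _, _, this⟩
  · have := simple_below_triangular (by omega) β (pairBraid a m) w _ (snd_mul_simple ha hm β)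
    rw [sg_mul_pairBraid_snd _ _ ha] at this
    exact ⟨_, _, _, this⟩

/-- The standard geometric biforks, written with `pairBraid`, as elements of the unital quotient
algebra. -/
def stdClass {k : ℕ} (x : Pair k × Pair k) : RingQuot (SkeinRel k) :=
  simple 0 (pairBraid x.1.1.1 x.1.1.2) (pairBraid x.2.1.1 x.2.1.2)⁻¹

theorem simple_mem_span_std {k : ℕ} (β γ : Braid (k + 1)) :
    simple 0 β γ ∈ Submodule.span Λ (Set.range (stdClass (k := k))) := by
  refine Submodule.span_le.2 ?_ (simple_mem_span_above β γ)
  rintro _ ⟨p, rfl⟩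
  refine Submodule.span_mono ?_ (simple_mem_span_below _ γ)
  rintro _ ⟨r, rfl⟩
  exact ⟨(p, r), rfl⟩

theorem skeinClass_mem_span_std {k : ℕ} (g : GeomBifork k) :
    skeinClass g ∈ Submodule.span Λ (Set.range (stdClass (k := k))) := by
  induction g using Quot.ind with
  | mk P =>
    obtain ⟨β, γ, h⟩ := exists_cls_eq_simple P.above P.cup P.middle P.below
    have h' : skeinClass (Quot.mk _ P) = simple 0 β γ := h
    rw [h']
    exact simple_mem_span_std β γ

theorem simple_mul_simple_mem_span_std {k : ℕ} (β γ β' γ' : Braid (k + 1)) :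
    simple 0 β γ * simple 0 β' γ' ∈ Submodule.span Λ (Set.range (stdClass (k := k))) := by
  have h := simple_resolve_below (k := k) (i := 0) (by omega) β (γ * β') γ' 0
  rw [simple_concat, mul_one] at h
  have h' : simple 0 β γ * simple 0 β' γ' = (1 - q) • simple 0 β (γ * β' * γ') -
      (simple 0 β (γ * β' * sg 0 * γ') - q • simple 0 β (γ * β' * (sg 0)⁻¹ * γ')) := by
    rw [h, sub_sub_cancel]
  rw [h']
  exact sub_mem (Submodule.smul_mem _ _ (simple_mem_span_std _ _)) (sub_mem
    (simple_mem_span_std _ _) (Submodule.smul_mem _ _ (simple_mem_span_std _ _)))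

theorem mem_span_std_of_mem_TAlg {k : ℕ} {x : RingQuot (SkeinRel k)} (hx : x ∈ TAlg k) :
    x ∈ Submodule.span Λ (Set.range (stdClass (k := k))) := by
  induction hx using NonUnitalAlgebra.adjoin_induction with
  | mem x hx => obtain ⟨g, rfl⟩ := hx; exact skeinClass_mem_span_std g
  | add x y _ _ hx hy => exact add_mem hx hy
  | zero => exact zero_mem _
  | smul r x _ hx => exact Submodule.smul_mem _ _ hx
  | mul x y hx' hy' hx hy =>
    clear hx' hy'
    induction hx, hy using Submodule.span_induction₂ with
    | mem_mem x y hx hy =>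
      obtain ⟨p, rfl⟩ := hx
      obtain ⟨r, rfl⟩ := hy
      exact simple_mul_simple_mem_span_std _ _ _ _
    | zero_left y hy => rw [zero_mul]; exact zero_mem _
    | zero_right x hx => rw [mul_zero]; exact zero_mem _
    | add_left x y z _ _ _ h1 h2 => rw [add_mul]; exact add_mem h1 h2
    | add_right x y z _ _ _ h1 h2 => rw [mul_add]; exact add_mem h1 h2
    | smul_left r x y _ _ h => rw [smul_mul_assoc]; exact Submodule.smul_mem _ _ h
    | smul_right r x y _ _ h => rw [mul_smul_comm]; exact Submodule.smul_mem _ _ h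

/-! ### Independence of the standard biforks -/

/-- The standard forks arise from `X_{0,1}` by the inverses of the standard braids. -/
theorem X_vecMul_pairBraid_inv {k : ℕ} (i j : ℕ) (hi : i < j) (hj : j < k + 2) :
    X k 0 1 ᵥ* K (pairBraid i j)⁻¹ = X k i j := by
  have step : ∀ m i j (hm : m < k + 1), i < j → j < k + 2 → (m = i ∧ m + 1 ≠ j ∨ m = j) →
      X k i j ᵥ* K (sg m)⁻¹ = if m = i then X k (i + 1) j else X k i (j + 1) := by
    intro m i j hm hi hj h
    rw [sg_eq hm, K_σ_inv, X_lkInv _ hi hj]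
    dsimp only [lkInvRow]
    split_ifs <;> first | rfl | omega
  have h0 : ∀ j, j + 1 < k + 2 → X k 0 1 ᵥ* K (pairBraid 0 (j + 1))⁻¹ = X k 0 (j + 1) := by
    intro j
    induction j with
    | zero => intro _; rw [pairBraid_zero_one, inv_one, K_one, vecMul_one]
    | succ j ih =>
      intro hj
      rw [← sg_mul_pairBraid_snd _ _ (by omega), _root_.mul_inv_rev, K_mul, ← vecMul_vecMul,
        ih (by omega), step _ _ _ (by omega) (by omega) (by omega) (by omega), if_neg (by omega)]
  induction i with
  | zero =>
    obtain ⟨j, rfl⟩ := Nat.exists_eq_succ_of_ne_zero (by omega : j ≠ 0)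
    exact h0 j hj
  | succ i ih =>
    rw [← sg_mul_pairBraid_fst, _root_.mul_inv_rev, K_mul, ← vecMul_vecMul, ih (by omega),
      step _ _ _ (by omega) (by omega) (by omega) (by omega), if_pos rfl]

/-- The specialization `q = 1`. -/
def evalOne : Λ →+* LaurentPolynomial ℤ := LaurentPolynomial.eval₂ (RingHom.id _) 1

theorem evalOne_q : evalOne q = 1 := by simp [evalOne, q]

theorem evalOne_qinv : evalOne qinv = 1 := by
  have := congrArg evalOne q_mul_qinv
  rwa [map_mul, evalOne_q, one_mul, map_one] at this

theorem evalOne_t : evalOne t = LaurentPolynomial.T 1 := by simp [evalOne, t]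

theorem evalOne_tinv : evalOne tinv = LaurentPolynomial.T (-1) := by simp [evalOne, tinv]

theorem evalOne_X (k i j : ℕ) (p : Pair k) :
    evalOne (X k i j p) = if p.1.1.val = i ∧ p.1.2.val = j then 1 else 0 := by
  rw [X]; split_ifs <;> simp

/-- At `q = 1` the generator `σ_m` maps the column at `(i, j)` to the column at `(i + 1, j)` if
`m = i`, and to the column at `(i, j + 1)` if `m = j`. -/
theorem evalOne_lkMat {k m i j i' j' : ℕ} (hm : m < k + 1) (hi : i < j) (hj : j < k + 2)
    (h : m = i ∧ m + 1 < j ∧ i' = i + 1 ∧ j' = j ∨ m = j ∧ i' = i ∧ j' = j + 1) (p : Pair k) :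
    evalOne (lkMat ⟨m, hm⟩ p ⟨(⟨i, by omega⟩, ⟨j, hj⟩), hi⟩) =
      if p.1.1.val = i' ∧ p.1.2.val = j' then 1 else 0 := by
  obtain ⟨⟨⟨a, ha⟩, ⟨b, hb⟩⟩, hp⟩ := p
  have hab : a < b := hp
  simp only [lkMat, of_apply, lkRow]
  split_ifs <;> simp only [Pi.add_apply, Pi.sub_apply, Pi.smul_apply, smul_eq_mul, map_add, map_sub,
    map_mul, map_neg, map_pow, map_one, evalOne_q, evalOne_X] <;> split_ifs <;>
    first | omega | simp

theorem evalOne_pairing_zero (i j : ℕ) (h : i < j) : evalOne (pairing 0 i j) =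
    if i = 0 ∧ j = 1 then LaurentPolynomial.T 1 - LaurentPolynomial.T (-1) else 0 := by
  unfold pairing
  split_ifs <;> first | omega | simp [evalOne_q, evalOne_qinv, evalOne_t, evalOne_tinv]

/-- At `q = 1` the standard coforks are multiples of the unit vectors. -/
theorem evalOne_K_pairBraid {k : ℕ} (i j : ℕ) (hi : i < j) (hj : j < k + 2) (p : Pair k) :
    evalOne ((K (pairBraid i j) *ᵥ adjCofork 0) p) =
      if p.1.1.val = i ∧ p.1.2.val = j then LaurentPolynomial.T 1 - LaurentPolynomial.T (-1)
      else 0 := by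
  have step : ∀ m i j i' j' (hm : m < k + 1) (hi : i < j) (hj : j < k + 2),
      (m = i ∧ m + 1 < j ∧ i' = i + 1 ∧ j' = j ∨ m = j ∧ i' = i ∧ j' = j + 1) →
      ∀ (v : Pair k → Λ), (∀ p : Pair k, evalOne (v p) =
        if p.1.1.val = i ∧ p.1.2.val = j then LaurentPolynomial.T 1 - LaurentPolynomial.T (-1)
        else 0) → ∀ p : Pair k, evalOne ((K (sg m) *ᵥ v) p) =
        if p.1.1.val = i' ∧ p.1.2.val = j' then LaurentPolynomial.T 1 - LaurentPolynomial.T (-1)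
        else 0 := by
    intro m i j i' j' hm hi hj h v hv p
    rw [sg_eq hm, K_σ, mulVec, dotProduct, map_sum,
      Finset.sum_eq_single ⟨(⟨i, by omega⟩, ⟨j, hj⟩), hi⟩]
    · rw [map_mul, evalOne_lkMat hm hi hj h, (hv _).trans (if_pos ⟨rfl, rfl⟩),
        ite_mul, one_mul, zero_mul]
    · intro r _ hr
      rw [map_mul, (hv r).trans (if_neg fun h =>
        hr (Subtype.ext (Prod.ext (Fin.ext h.1) (Fin.ext h.2)))), mul_zero]
    · exact fun h => absurd (Finset.mem_univ _) h
  have h0 : ∀ j, j + 1 < k + 2 → ∀ p : Pair k,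
      evalOne ((K (pairBraid 0 (j + 1)) *ᵥ adjCofork 0) p) =
      if p.1.1.val = 0 ∧ p.1.2.val = j + 1 then LaurentPolynomial.T 1 - LaurentPolynomial.T (-1)
      else 0 := by
    intro j
    induction j with
    | zero =>
      intro _ p
      rw [pairBraid_zero_one, K_one, one_mulVec, adjCofork_apply]
      exact evalOne_pairing_zero _ _ p.2
    | succ j ih =>
      intro hj
      rw [← sg_mul_pairBraid_snd _ _ (by omega), K_mul, ← mulVec_mulVec]
      exact step (j + 1) 0 (j + 1) 0 (j + 1 + 1) (by omega) (by omega) (by omega) (by omega) _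
        (ih (by omega))
  induction i generalizing p with
  | zero =>
    obtain ⟨j, rfl⟩ := Nat.exists_eq_succ_of_ne_zero (by omega : j ≠ 0)
    exact h0 j hj p
  | succ i ih =>
    rw [← sg_mul_pairBraid_fst, K_mul, ← mulVec_mulVec]
    exact step i i j (i + 1) j (by omega) (by omega) hj (by omega) _ (ih (by omega)) p

/-- The matrix whose columns are the standard coforks `X*_{i,j}`. -/
def coforkMat (k : ℕ) : Matrix (Pair k) (Pair k) Λ :=
  Matrix.of fun p r => (K (pairBraid r.1.1 r.1.2) *ᵥ adjCofork 0) p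

theorem coforkMat_det_ne_zero (k : ℕ) : (coforkMat k).det ≠ 0 := by
  intro h
  have h1 : evalOne.mapMatrix (coforkMat k) = Matrix.diagonal fun _ =>
      LaurentPolynomial.T 1 - LaurentPolynomial.T (-1) := by
    ext1 p r
    rw [RingHom.mapMatrix_apply, Matrix.map_apply, coforkMat, of_apply,
      evalOne_K_pairBraid _ _ r.2 r.1.2.2, Matrix.diagonal_apply]
    congr 1
    rw [Subtype.ext_iff, Prod.ext_iff, Fin.ext_iff, Fin.ext_iff]
  have h2 := RingHom.map_det evalOne (coforkMat k)
  rw [h, map_zero, h1, det_diagonal, Finset.prod_const] at h2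
  have h3 : (LaurentPolynomial.T 1 - LaurentPolynomial.T (-1) : LaurentPolynomial ℤ) = 0 :=
    eq_zero_of_pow_eq_zero h2.symm
  have h4 := congrArg (fun f : LaurentPolynomial ℤ => f.coeff 1) h3
  simp [LaurentPolynomial.T_apply] at h4

theorem skeinRep_stdClass {k : ℕ} (x : Pair k × Pair k) :
    skeinRep k (stdClass x) = vecMulVec (fun p => coforkMat k p x.1) (Pi.single x.2 1) := by
  rw [stdClass, simple_zero_eq_attach, skeinRep_attach, bifork, ← biforkAt_zero, biforkAt_eq,
    mul_vecMulVec, vecMulVec_mul, ← X_eq_single,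
    ← X_vecMul_pairBraid_inv _ _ x.2.2 x.2.1.2.2]
  rfl

/-- The representation is faithful on the span of the geometric biforks. -/
theorem eq_zero_of_skeinRep_eq_zero {k : ℕ} {x : RingQuot (SkeinRel k)} (hx : x ∈ TAlg k)
    (h : skeinRep k x = 0) : x = 0 := by
  obtain ⟨a, rfl⟩ := (Submodule.mem_span_range_iff_exists_fun Λ).1 (mem_span_std_of_mem_TAlg hx)
  have h1 : ∀ r, coforkMat k *ᵥ (fun p => a (p, r)) = 0 := by
    intro r
    funext p
    have h2 : skeinRep k (∑ y, a y • stdClass y) p r = 0 := by rw [h]; rfl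
    rw [map_sum, Matrix.sum_apply, Fintype.sum_prod_type_right, Finset.sum_eq_single r] at h2
    · rw [Pi.zero_apply, ← h2, mulVec, dotProduct]
      refine Finset.sum_congr rfl fun s _ => ?_
      rw [map_smul, skeinRep_stdClass]
      simp [vecMulVec_apply, mul_comm]
    · intro s _ hs
      refine Finset.sum_eq_zero fun s' _ => ?_
      rw [map_smul, skeinRep_stdClass]
      simp [vecMulVec_apply, hs]
    · exact fun h => absurd (Finset.mem_univ _) h
  have h2 : ∀ y, a y = 0 := fun y =>
    congrFun (Matrix.eq_zero_of_mulVec_eq_zero (coforkMat_det_ne_zero k) (h1 y.2)) y.1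
  exact Finset.sum_eq_zero fun y _ => by rw [h2, zero_smul]

theorem skeinRep_mem_MAlg {k : ℕ} {x : RingQuot (SkeinRel k)} (hx : x ∈ TAlg k) :
    skeinRep k x ∈ MAlg k := by
  induction hx using NonUnitalAlgebra.adjoin_induction with
  | mem x hx =>
    obtain ⟨g, rfl⟩ := hx
    induction g using Quot.ind with
    | mk P =>
      obtain ⟨β, γ, h⟩ := exists_cls_eq_simple P.above P.cup P.middle P.below
      have h' : skeinClass (Quot.mk _ P) = simple 0 β γ := h
      rw [h', simple_zero_eq_attach, skeinRep_attach]
      exact Submodule.subset_span ⟨β, γ, rfl⟩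
  | add x y _ _ hx hy => rw [map_add]; exact add_mem hx hy
  | zero => rw [map_zero]; exact zero_mem _
  | smul r x _ hx => rw [map_smul]; exact SMulMemClass.smul_mem _ hx
  | mul x y _ _ hx hy => rw [map_mul]; exact mul_mem hx hy

theorem exists_skeinRep_eq {k : ℕ} {M : Matrix (Pair k) (Pair k) Λ} (hM : M ∈ MAlg k) :
    ∃ x ∈ TAlg k, skeinRep k x = M := by
  have hM' : M ∈ Submodule.span Λ {M | ∃ β γ : Braid (k + 1), M = bifork β γ} := hM
  induction hM' using Submodule.span_induction with
  | mem M h =>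
    obtain ⟨β, γ, rfl⟩ := h
    exact ⟨_, NonUnitalAlgebra.subset_adjoin Λ ⟨attach β γ, rfl⟩, skeinRep_attach β γ⟩
  | zero => exact ⟨0, zero_mem _, map_zero _⟩
  | add M N _ _ h1 h2 =>
    obtain ⟨x, hx, rfl⟩ := h1 ‹_›
    obtain ⟨y, hy, rfl⟩ := h2 ‹_›
    exact ⟨x + y, add_mem hx hy, map_add _ _ _⟩
  | smul r M _ h =>
    obtain ⟨x, hx, rfl⟩ := h ‹_›
    exact ⟨r • x, SMulMemClass.smul_mem r hx, map_smul _ _ _⟩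

/-- The homomorphism from the skein algebra of geometric biforks to the matrix algebra of
biforks. -/
def biforkHom (k : ℕ) : TAlg k →ₙₐ[Λ] MAlg k :=
  NonUnitalAlgHom.codRestrict
    ((skeinRep k : RingQuot (SkeinRel k) →ₙₐ[Λ] Matrix (Pair k) (Pair k) Λ).comp
      (NonUnitalSubalgebraClass.subtype (TAlg k)))
    (MAlg k) fun x => skeinRep_mem_MAlg x.2

theorem biforkHom_bijective (k : ℕ) : Function.Bijective (biforkHom k) := by
  constructor
  · intro x y hxy
    have h : skeinRep k x.1 = skeinRep k y.1 := congrArg Subtype.val hxy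
    -- the source is not declared as an additive group, so differences are formed with `-1 : Λ`
    have h1 : x.1 + (-1 : Λ) • y.1 = 0 := eq_zero_of_skeinRep_eq_zero
      (add_mem x.2 (SMulMemClass.smul_mem _ y.2)) (by
        rw [map_add, map_smul, h]
        exact (congrArg _ (neg_one_smul Λ (skeinRep k y.1))).trans (add_neg_cancel _))
    rw [neg_smul, one_smul, ← sub_eq_add_neg, sub_eq_zero] at h1
    exact Subtype.ext h1
  · rintro ⟨M, hM⟩
    obtain ⟨x, hx, h⟩ := exists_skeinRep_eq hM
    exact ⟨⟨x, hx⟩, Subtype.ext h⟩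

end

end LKBifork
open LKBifork in
/-- For `n = k + 2` strings, the skein algebra of geometric biforks is isomorphic to the matrix
algebra of biforks, standard geometric biforks going to standard biforks. -/
theorem theorem5p1 (k : ℕ) :
    ∃ ρ : TAlg k →ₙₐ[Λ] MAlg k, Function.Bijective ρ ∧
      ∀ p r : Pair k, ρ (stdGeomBifork p r) = stdBifork p r :=
  ⟨biforkHom k, biforkHom_bijective k, fun _ _ => Subtype.ext (skeinRep_attach _ _)⟩
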